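/- **Setting.** Let $\Gamma$ be an infinite connected graph without loops or multiple edges, with symmetric weights $\mu_{x,y}=\mu_{y,x}>0$ on the edges $x\sim y$ (and $\mu_{x,y}=0$ otherwise) such that $\mu(x)=\sum_{y\sim x}\mu_{x,y}<\infty$ for every vertex $x$. Let $(X_k)_{k\ge 0}$ be the random walk with transition probabilities $P(x,y)=\mu_{x,y}/\mu(x)$, and let $\mathbb P_x,\mathbb E_x$ refer to the walk started at $X_0=x$. Let $d$ be the graph distance and, for real $R$, $B(x,R)=\{y: d(x,y)<R\}$. For $A\subset\Gamma$ let $T_A=\inf\{t\ge 0: X_t\notin A\}$, and put $\tau_{y,r}=\inf\{t\ge 0: X_t\in B(y,r)\}$ and $E(x,R)=\mathbb E_x[T_{B(x,R)}]$. Let $\pi_{x,y}$ be the set of vertices lying on some shortest path from $x$ to $y$. For constants $Q,C>0$, vertices $x,y$ and real $n,R$, let $l_C(x,y,n,R)$ (which also depends on $Q$) be the least positive integer $l$ such that $$\frac nl\ \ge\ Q\max_{z\in\pi_{x,y}}E\Big(z,\frac{CR}{l}\Big),$$ and let $l_C(x,y,n,R)=R$ if there is no such integer. (If $R\le 0$ and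 $n>0$ the balls are empty, so $E=0$ and $l_C(x,y,n,R)=1$.) Condition $(p_0)$: there is $p_0>0$ such that $P(x,y)\ge p_0$ for all $x\sim y$. Elliptic Harnack inequality $(H)$: there is a constant $C_H>0$ such that for all $x\in\Gamma$, $R>0$ and every function $u$ that is non-negative on $B(x,2R)$ and on all neighbours of its vertices and harmonic on $B(x,2R)$ (that is, $\sum_y P(z,y)u(y)=u(z)$ for $z\in B(x,2R)$), one has $\max_{B(x,R)}u\le C_H\min_{B(x,R)}u$. **Proposition 3.6.** Assume that $(\Gamma,\mu)$ satisfies $(p_0)$ and $(H)$. Then there are constants $Q,c,C,C'>0$ such that for all $x,y\in\Gamma$, all real $r\ge 1$ with $d(x,y)\le 4r$, and all real $n>0$ with $n>d(x,y)-\lceil r\rceil+1$, $$\mathbb P_x(\tau_{y,r}<n)\ \ge\ c\,\exp\big[-C'\,l_C\big(x,y,n,d(x,y)-r\big)\big].$$ -/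

import Mathlib

open MeasureTheory ProbabilityTheory
open scoped ENNReal NNReal

noncomputable section

/-- A connected weighted graph `(Γ, μ)` without loops or multiple edges: symmetric weights
`weight x y`, positive exactly on the edges, with finite total weight at each vertex. -/
structure WeightedGraph (V : Type*) where
  graph : SimpleGraph V
  connected : graph.Connected
  weight : V → V → ℝ
  weight_symm : ∀ x y, weight x y = weight y x
  weight_pos : ∀ x y, graph.Adj x y → 0 < weight x y
  weight_eq_zero : ∀ x y, ¬ graph.Adj x y → weight x y = 0
  weight_summable : ∀ x, Summable (weight x)

namespace WeightedGraph

variable {V : Type*} (Γ : WeightedGraph V)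

/-- The measure of a vertex, `μ(x) = ∑_{y ∼ x} μ_{x,y}`. -/
def vertexWeight (x : V) : ℝ := ∑' y, Γ.weight x y

/-- The one-step transition probability `P(x,y) = μ_{x,y} / μ(x)`. -/
def P (x y : V) : ℝ := Γ.weight x y / Γ.vertexWeight x

theorem weight_nonneg (x y : V) : 0 ≤ Γ.weight x y := by
  by_cases h : Γ.graph.Adj x y
  · exact (Γ.weight_pos x y h).le
  · exact (Γ.weight_eq_zero x y h).ge

theorem vertexWeight_pos [Infinite V] (x : V) : 0 < Γ.vertexWeight x := by
  obtain ⟨y, hy⟩ := Γ.connected.preconnected.exists_adj_of_nontrivial x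
  exact (Γ.weight_summable x).tsum_pos (Γ.weight_nonneg x) y (Γ.weight_pos x y hy)

theorem P_nonneg (x y : V) : 0 ≤ Γ.P x y :=
  div_nonneg (Γ.weight_nonneg x y) (tsum_nonneg (Γ.weight_nonneg x))

theorem hasSum_P [Infinite V] (x : V) : HasSum (Γ.P x) 1 := by
  have h := (Γ.weight_summable x).hasSum.div_const (Γ.vertexWeight x)
  have h1 : (∑' y, Γ.weight x y) / Γ.vertexWeight x = 1 := div_self (Γ.vertexWeight_pos x).ne'
  rwa [h1] at h

/-- The distribution of one step of the walk started at `x`: mass `P(x,y)` at `y`. -/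
def step [Infinite V] (x : V) : PMF V :=
  ⟨fun y => ENNReal.ofReal (Γ.P x y), by
    rw [ENNReal.summable.hasSum_iff,
      ← ENNReal.ofReal_tsum_of_nonneg (Γ.P_nonneg x) (Γ.hasSum_P x).summable,
      (Γ.hasSum_P x).tsum_eq, ENNReal.ofReal_one]⟩

/-- The graph distance (length of a shortest path). -/
def d (x y : V) : ℕ := Γ.graph.dist x y

/-- The open ball `B(x,R) = {y : d(x,y) < R}`, with real radius. -/
def ball (x : V) (R : ℝ) : Set V := {y | (Γ.d x y : ℝ) < R}

/-- The union of the vertex sets of the shortest paths connecting `x` and `y`. -/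
def geodesicHull (x y : V) : Set V :=
  {z | ∃ p : Γ.graph.Walk x y, p.length = Γ.d x y ∧ z ∈ p.support}

/-- Condition `(p₀)`. -/
def UniformlyElliptic : Prop := ∃ p₀ : ℝ, 0 < p₀ ∧ ∀ x y, Γ.graph.Adj x y → p₀ ≤ Γ.P x y

/-- `A` together with all neighbours of its points. -/
def withNeighbors (A : Set V) : Set V := A ∪ {y | ∃ x ∈ A, Γ.graph.Adj x y}

/-- `h` is harmonic on `A` (only the values of `h` on `A` and its neighbours matter). -/
def HarmonicOn (h : V → ℝ) (A : Set V) : Prop :=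
  ∀ x ∈ A, HasSum (fun y => Γ.P x y * h y) (h x)

/-- The elliptic Harnack inequality `(H)`. -/
def EllipticHarnack : Prop :=
  ∃ C : ℝ, 0 < C ∧ ∀ (x : V) (R : ℝ), 0 < R → ∀ u : V → ℝ,
    (∀ y ∈ Γ.withNeighbors (Γ.ball x (2 * R)), 0 ≤ u y) → Γ.HarmonicOn u (Γ.ball x (2 * R)) →
      ∀ y ∈ Γ.ball x R, ∀ z ∈ Γ.ball x R, u y ≤ C * u z

/-- The exit time `T_A` of a trajectory: the first `t ≥ 0` with `X_t ∉ A` (`⊤` if none). -/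
def exitTime (A : Set V) (ω : ℕ → V) : ℕ∞ := ⨅ (t : ℕ) (_ : ω t ∉ A), (t : ℕ∞)

/-- The hitting time `τ_A = T_{Aᶜ}`. -/
def hittingTime (A : Set V) (ω : ℕ → V) : ℕ∞ := exitTime Aᶜ ω

variable [Infinite V] [MeasurableSpace V] [DiscreteMeasurableSpace V]

/-- The one-step transition kernel of the walk. -/
def stepKernel : Kernel V V := ⟨fun x => (Γ.step x).toMeasure, .of_discrete⟩

instance : IsMarkovKernel Γ.stepKernel :=
  ⟨fun x => inferInstanceAs (IsProbabilityMeasure (Γ.step x).toMeasure)⟩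

/-- The transition from the history `(X₀, …, Xₙ)` to `Xₙ₊₁`: a step from the last position. -/
def historyKernel (n : ℕ) : Kernel ((i : Finset.Iic n) → V) V :=
  Γ.stepKernel.comap (fun h => h ⟨n, Finset.mem_Iic.2 le_rfl⟩) (measurable_pi_apply _)

instance (n : ℕ) : IsMarkovKernel (Γ.historyKernel n) := by
  unfold historyKernel; infer_instance

/-- The law `ℙ_x` of the random walk `(Xₙ)` started at `X₀ = x`, on the space of trajectories. -/
def law (x : V) : Measure (ℕ → V) := Kernel.traj (X := fun _ => V) Γ.historyKernel 0 (fun _ => x)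

/-- The mean exit time `E(x,R) = 𝔼_x[T_{B(x,R)}]`. -/
def meanExitTime (x : V) (R : ℝ) : ℝ≥0∞ :=
  ∫⁻ ω, (exitTime (Γ.ball x R) ω : ℝ≥0∞) ∂(Γ.law x)

/-- The admissible chain lengths: positive integers `l` with
`n / l ≥ Q max_{z ∈ π_{x,y}} E(z, C R / l)`. -/
def admissible (Q C : ℝ) (x y : V) (n R : ℝ) : Set ℕ :=
  {l | 0 < l ∧ ∀ z ∈ Γ.geodesicHull x y,
    ENNReal.ofReal Q * Γ.meanExitTime z (C * R / l) ≤ ENNReal.ofReal (n / l)}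

open Classical in
/-- `l_C(x,y,n,R)`: the least admissible chain length, and `R` if there is none. -/
def chainLength (Q C : ℝ) (x y : V) (n R : ℝ) : ℝ :=
  if (Γ.admissible Q C x y n R).Nonempty then ((sInf (Γ.admissible Q C x y n R) : ℕ) : ℝ) else R

/-- `ℙ_x(τ_{y,r} < n)`. -/
def hitProb (x y : V) (r n : ℝ) : ℝ :=
  (Γ.law x).real {ω | (hittingTime (Γ.ball y r) ω : ℝ≥0∞) < ENNReal.ofReal n}

end WeightedGraph

end

/-! Put `R = d(x,y) - r`. If `R` is at most a constant times `l`, a geodesic is followed: each step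
has probability at least `p₀`. Otherwise set `ρ ≈ R/(200 l)` and place at most `12 l` points on a
geodesic, at spacing `42ρ`, ending well inside `B(y,r)`. The walk is made to visit the balls of
radius `17ρ` about these points in turn, never leaving the ball of radius `100ρ` about the current
point before reaching the next one.

Two facts are needed. Each passage has probability bounded below: the passage function is compared
with a Green density, whose values away from the pole are comparable by Harnack chains and symmetry
(`IsGreen.le_of_away`). And the walk is not slow given success. If `h` is the success probability
and `M` dominates the expected time on success, a Markov-type inequality gives success within `k`
steps with probability at least `h - M/(k+1)` (`sub_div_le_hitBy`), so `M ≤ (n/2) h` at the starting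
point suffices.

The mean exit time is controlled only at centres, not throughout balls. So `hitBy_step` splits the
time cost into the exit time of a smaller ball and a harmonic part. Harnack bounds the harmonic part
by its central value, adding a constant times `E` per link; the exit-time part is absorbed at the
next link and does not accumulate. Over at most `12 l` links the cost is at most a constant times `l
E`, where admissibility of `l` gives `E ≤ n/(lQ)`. -/

namespace WeightedGraph

/-! ### Potential theory on finite sets: minimum principle, Dirichlet problem, exit times, Green
densities. -/

section Potential

variable {V : Type*} (Γ : WeightedGraph V)

/-- The averaging operator `f ↦ Pf` of the walk. -/
noncomputable def avg (f : V → ℝ) (x : V) : ℝ := ∑' y, Γ.P x y * f y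

/-- Every vertex has finitely many neighbours. -/
def LocallyFinite : Prop := ∀ x, {y | Γ.graph.Adj x y}.Finite

variable {Γ}

theorem P_eq_zero {x y : V} (h : ¬ Γ.graph.Adj x y) : Γ.P x y = 0 := by
  simp [P, Γ.weight_eq_zero x y h]

theorem P_pos [Infinite V] {x y : V} (h : Γ.graph.Adj x y) : 0 < Γ.P x y :=
  div_pos (Γ.weight_pos x y h) (Γ.vertexWeight_pos x)

/-- Transition probabilities sum to one, so only finitely many can reach `p₀`. This makes balls
finite and every Dirichlet problem below finite-dimensional. -/
theorem UniformlyElliptic.locallyFinite [Infinite V] (h : Γ.UniformlyElliptic) :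
    Γ.LocallyFinite := by
  obtain ⟨p, hp, h⟩ := h
  intro x
  have hs := (Γ.hasSum_P x).summable.tendsto_cofinite_zero
  have h2 := hs.eventually (gt_mem_nhds hp)
  rw [Filter.eventually_cofinite] at h2
  exact h2.subset fun y hy => by simpa using h x y hy

namespace LocallyFinite

theorem support_finite (hf : Γ.LocallyFinite) (f : V → ℝ) (x : V) :
    (Function.support fun y => Γ.P x y * f y).Finite :=
  (hf x).subset fun y hy => by
    by_contra h
    exact hy (by simp [P_eq_zero h])

theorem summable (hf : Γ.LocallyFinite) (f : V → ℝ) (x : V) :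
    Summable fun y => Γ.P x y * f y :=
  summable_of_hasFiniteSupport (hf.support_finite f x)

theorem harmonicOn_iff (hf : Γ.LocallyFinite) {f : V → ℝ} {A : Set V} :
    Γ.HarmonicOn f A ↔ ∀ x ∈ A, Γ.avg f x = f x :=
  forall₂_congr fun x _ => (hf.summable f x).hasSum_iff

theorem avg_add (hf : Γ.LocallyFinite) (f g : V → ℝ) (x : V) :
    Γ.avg (fun y => f y + g y) x = Γ.avg f x + Γ.avg g x := by
  unfold avg
  rw [← (hf.summable f x).tsum_add (hf.summable g x)]
  simp only [mul_add]

theorem avg_sub (hf : Γ.LocallyFinite) (f g : V → ℝ) (x : V) :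
    Γ.avg (fun y => f y - g y) x = Γ.avg f x - Γ.avg g x := by
  unfold avg
  rw [← (hf.summable f x).tsum_sub (hf.summable g x)]
  simp only [mul_sub]

theorem avg_mono (hf : Γ.LocallyFinite) {f g : V → ℝ} {x : V}
    (h : ∀ y, Γ.graph.Adj x y → f y ≤ g y) : Γ.avg f x ≤ Γ.avg g x := by
  refine (hf.summable f x).tsum_le_tsum (fun y => ?_) (hf.summable g x)
  by_cases hy : Γ.graph.Adj x y
  · exact mul_le_mul_of_nonneg_left (h y hy) (Γ.P_nonneg x y)
  · simp [P_eq_zero hy]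

end LocallyFinite

theorem avg_mul_left (c : ℝ) (f : V → ℝ) (x : V) :
    Γ.avg (fun y => c * f y) x = c * Γ.avg f x := by
  unfold avg
  rw [← tsum_mul_left]
  exact tsum_congr fun y => by ring

theorem avg_const [Infinite V] (c : ℝ) (x : V) : Γ.avg (fun _ => c) x = c := by
  unfold avg
  rw [tsum_mul_right, (Γ.hasSum_P x).tsum_eq, one_mul]

theorem avg_nonneg {f : V → ℝ} (h : ∀ y, 0 ≤ f y) (x : V) : 0 ≤ Γ.avg f x :=
  tsum_nonneg fun y => mul_nonneg (Γ.P_nonneg x y) (h y)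

theorem LocallyFinite.P_mul_le_avg (hf : Γ.LocallyFinite) {f : V → ℝ} (h : ∀ y, 0 ≤ f y) (x y : V) :
    Γ.P x y * f y ≤ Γ.avg f x :=
  (hf.summable f x).le_tsum y fun z _ => mul_nonneg (Γ.P_nonneg x z) (h z)

theorem eq_univ_of_adj_closed (Γ : WeightedGraph V) {S : Set V} (hne : S.Nonempty)
    (hS : ∀ x ∈ S, ∀ y, Γ.graph.Adj x y → y ∈ S) : S = Set.univ := by
  obtain ⟨x, hx⟩ := hne
  refine Set.eq_univ_of_forall fun y => ?_
  obtain ⟨p⟩ := Γ.connected.preconnected x y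
  induction p with
  | nil => exact hx
  | cons h p ih => exact ih (hS _ hx _ h)

variable [Infinite V]

/-- The minimum principle on finite sets. -/
theorem LocallyFinite.nonneg_of_superharmonic (hf : Γ.LocallyFinite) {D : Set V} (hD : D.Finite)
    {f : V → ℝ} (hsup : ∀ x ∈ D, Γ.avg f x ≤ f x)
    (hbd : ∀ x ∈ D, ∀ y ∉ D, Γ.graph.Adj x y → 0 ≤ f y) : ∀ x ∈ D, 0 ≤ f x := by
  by_contra! hcon
  obtain ⟨w, hwD, hw⟩ := hcon
  obtain ⟨a, haD, ha⟩ := hD.exists_minimalFor f D ⟨w, hwD⟩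
  have hmin : ∀ x ∈ D, f a ≤ f x := fun x hx => by
    rcases le_total (f a) (f x) with h | h
    · exact h
    · exact ha hx h
  have hneg : f a < 0 := (hmin w hwD).trans_lt hw
  -- A negative minimum spreads to all neighbours, hence to the whole connected graph, which is
  -- infinite while `D` is finite.
  have huniv : {x | x ∈ D ∧ f x = f a} = Set.univ := by
    refine Γ.eq_univ_of_adj_closed ⟨a, haD, rfl⟩ ?_
    rintro x ⟨hxD, hx⟩ y hxy
    have hge : ∀ z, Γ.graph.Adj x z → f a ≤ f z := fun z hz => by
      by_cases hzD : z ∈ D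
      · exact hmin z hzD
      · exact hneg.le.trans (hbd x hxD z hzD hz)
    have hle : f y ≤ f a := by
      by_contra! hlt
      have h1 : Γ.avg (fun _ => f a) x < Γ.avg f x := by
        refine (hf.summable _ x).tsum_lt_tsum (i := y) (fun z => ?_) ?_ (hf.summable f x)
        · by_cases hz : Γ.graph.Adj x z
          · exact mul_le_mul_of_nonneg_left (hge z hz) (Γ.P_nonneg x z)
          · simp [P_eq_zero hz]
        · exact mul_lt_mul_of_pos_left hlt (P_pos hxy)
      rw [avg_const] at h1
      linarith [hsup x hxD]
    have hyD : y ∈ D := by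
      by_contra h
      linarith [hbd x hxD y h hxy]
    exact ⟨hyD, le_antisymm hle (hmin y hyD)⟩
  have hfin : {x | x ∈ D ∧ f x = f a}.Finite := hD.subset fun x hx => hx.1
  rw [huniv] at hfin
  exact Set.infinite_univ hfin

/-- The comparison principle on finite sets. -/
theorem LocallyFinite.le_of_boundary_le (hf : Γ.LocallyFinite) {D : Set V} (hD : D.Finite)
    {f g : V → ℝ} (hfg : ∀ x ∈ D, f x - Γ.avg f x ≤ g x - Γ.avg g x)
    (hbd : ∀ x ∈ D, ∀ y ∉ D, Γ.graph.Adj x y → f y ≤ g y) : ∀ x ∈ D, f x ≤ g x := by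
  have := hf.nonneg_of_superharmonic hD (f := fun x => g x - f x)
    (fun x hx => by rw [hf.avg_sub]; linarith [hfg x hx])
    (fun x hx y hy hxy => by linarith [hbd x hx y hy hxy])
  exact fun x hx => by linarith [this x hx]

/-- Solvability of the Dirichlet problem on finite sets. -/
theorem LocallyFinite.exists_dirichlet (hf : Γ.LocallyFinite) {D : Set V} (hD : D.Finite)
    (f φ : V → ℝ) :
    ∃ h : V → ℝ, (∀ x ∈ D, h x - Γ.avg h x = f x) ∧ ∀ x ∉ D, h x = φ x := by
  classical
  have : Fintype D := hD.fintype
  let ext : (D → ℝ) → V → ℝ := fun k x => if hx : x ∈ D then k ⟨x, hx⟩ else 0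
  have ext_add : ∀ k l x, ext (k + l) x = ext k x + ext l x := fun k l x => by
    by_cases hx : x ∈ D <;> simp [ext, hx]
  have ext_smul : ∀ (c : ℝ) k x, ext (c • k) x = c * ext k x := fun c k x => by
    by_cases hx : x ∈ D <;> simp [ext, hx]
  have ext_coe : ∀ k (x : D), ext k x = k x := fun k x => by simp [ext]
  have ext_out : ∀ k x, x ∉ D → ext k x = 0 := fun k x hx => by simp [ext, hx]
  let T : (D → ℝ) →ₗ[ℝ] (D → ℝ) :=
    { toFun := fun k x => k x - Γ.avg (ext k) x
      map_add' := fun k l => by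
        funext x
        have : ext (k + l) = fun y => ext k y + ext l y := funext (ext_add k l)
        simp only [this, hf.avg_add, Pi.add_apply]
        ring
      map_smul' := fun c k => by
        funext x
        have : ext (c • k) = fun y => c * ext k y := funext (ext_smul c k)
        simp only [this, avg_mul_left, Pi.smul_apply, smul_eq_mul, RingHom.id_apply]
        ring }
  have hker : ∀ k, T k = 0 → ∀ x, 0 ≤ k x := by
    intro k hk x
    rw [← ext_coe k x]
    refine hf.nonneg_of_superharmonic hD (fun y hy => ?_) (fun y _ z hz _ => ?_) x x.2
    · have := congrFun hk ⟨y, hy⟩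
      simp only [T, LinearMap.coe_mk, AddHom.coe_mk, Pi.zero_apply] at this
      have h2 := ext_coe k ⟨y, hy⟩
      simp only at h2
      linarith
    · rw [ext_out k z hz]
  have hinj : Function.Injective T := by
    rw [← LinearMap.ker_eq_bot, LinearMap.ker_eq_bot']
    intro k hk
    funext x
    have h1 := hker k hk x
    have h2 := hker (-k) (by rw [map_neg, hk, neg_zero]) x
    simp only [Pi.neg_apply, Pi.zero_apply] at h2 ⊢
    linarith
  -- The boundary data move to the right-hand side, leaving a problem with zero exterior values.
  obtain ⟨k, hk⟩ := LinearMap.injective_iff_surjective.1 hinj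
    (fun x => f x + Γ.avg (fun y => if y ∈ D then 0 else φ y) x)
  refine ⟨fun x => ext k x + if x ∈ D then 0 else φ x, fun x hx => ?_, fun x hx => ?_⟩
  · have := congrFun hk ⟨x, hx⟩
    simp only [T, LinearMap.coe_mk, AddHom.coe_mk] at this
    have h2 := ext_coe k ⟨x, hx⟩
    simp only at h2
    rw [hf.avg_add]
    simp only [if_pos hx]
    linarith
  · simp [ext_out k x hx, hx]

/-- `e` is the mean exit time of `D`: it solves `e - Pe = 1` on `D`, `e = 0` outside. -/
def IsExit (Γ : WeightedGraph V) (D : Set V) (e : V → ℝ) : Prop :=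
  (∀ x ∈ D, e x - Γ.avg e x = 1) ∧ ∀ x ∉ D, e x = 0

theorem LocallyFinite.exists_isExit (hf : Γ.LocallyFinite) {D : Set V} (hD : D.Finite) :
    ∃ e, Γ.IsExit D e := hf.exists_dirichlet hD (fun _ => 1) fun _ => 0

theorem IsExit.nonneg (hf : Γ.LocallyFinite) {D : Set V} (hD : D.Finite) {e : V → ℝ}
    (he : Γ.IsExit D e) (x : V) : 0 ≤ e x := by
  by_cases hx : x ∈ D
  · exact hf.nonneg_of_superharmonic hD (fun y hy => by linarith [he.1 y hy])
      (fun y _ z hz _ => (he.2 z hz).ge) x hx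
  · exact (he.2 x hx).ge

theorem IsExit.mono (hf : Γ.LocallyFinite) {D D' : Set V} (hD' : D'.Finite) (hDD : D ⊆ D')
    {e e' : V → ℝ} (he : Γ.IsExit D e) (he' : Γ.IsExit D' e') (x : V) : e x ≤ e' x := by
  by_cases hx : x ∈ D
  · refine hf.le_of_boundary_le (hD'.subset hDD) (fun y hy => ?_) (fun y _ z hz _ => ?_) x hx
    · rw [he.1 y hy, he'.1 y (hDD hy)]
    · rw [he.2 z hz]
      exact he'.nonneg hf hD' z
  · rw [he.2 x hx]
    exact he'.nonneg hf hD' x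

/-- `γ` is the Green density of the walk killed outside `D`, with pole `b`. -/
def IsGreen (Γ : WeightedGraph V) (D : Set V) (b : V) (γ : V → ℝ) : Prop :=
  (∀ x ∈ D, x ≠ b → Γ.avg γ x = γ x) ∧ γ b - Γ.avg γ b = (Γ.vertexWeight b)⁻¹ ∧ ∀ x ∉ D, γ x = 0

theorem LocallyFinite.exists_isGreen (hf : Γ.LocallyFinite) {D : Set V} (hD : D.Finite) {b : V}
    (hb : b ∈ D) : ∃ γ, Γ.IsGreen D b γ := by
  classical
  obtain ⟨h, h1, h2⟩ := hf.exists_dirichlet hD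
    (fun x => if x = b then (Γ.vertexWeight b)⁻¹ else 0) fun _ => 0
  refine ⟨h, fun x hx hxb => ?_, ?_, h2⟩
  · have := h1 x hx
    rw [if_neg hxb] at this
    linarith
  · rw [h1 b hb, if_pos rfl]

theorem IsGreen.nonneg (hf : Γ.LocallyFinite) {D : Set V} (hD : D.Finite) {b : V} {γ : V → ℝ}
    (h : Γ.IsGreen D b γ) (x : V) : 0 ≤ γ x := by
  by_cases hx : x ∈ D
  · refine hf.nonneg_of_superharmonic hD (fun y hy => ?_) (fun y _ z hz _ => (h.2.2 z hz).ge) x hx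
    by_cases hyb : y = b
    · subst hyb
      have := h.2.1
      have := inv_nonneg.2 (Γ.vertexWeight_pos y).le
      linarith
    · exact (h.1 y hy hyb).le
  · exact (h.2.2 x hx).ge

theorem vertexWeight_mul_avg (f : V → ℝ) (x : V) :
    Γ.vertexWeight x * Γ.avg f x = ∑' y, Γ.weight x y * f y := by
  unfold avg P
  rw [← tsum_mul_left]
  refine tsum_congr fun y => ?_
  have := (Γ.vertexWeight_pos x).ne'
  field_simp

theorem sum_mul_avg_comm {D : Set V} (hD : D.Finite)
    {f g : V → ℝ} (hf0 : ∀ x ∉ D, f x = 0) (hg0 : ∀ x ∉ D, g x = 0) :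
    ∑ x ∈ hD.toFinset, Γ.vertexWeight x * (f x * Γ.avg g x) =
      ∑ x ∈ hD.toFinset, Γ.vertexWeight x * (g x * Γ.avg f x) := by
  have key : ∀ f g : V → ℝ, (∀ x ∉ D, g x = 0) →
      ∑ x ∈ hD.toFinset, Γ.vertexWeight x * (f x * Γ.avg g x) =
        ∑ x ∈ hD.toFinset, ∑ y ∈ hD.toFinset, f x * (Γ.weight x y * g y) := by
    intro f g hg0
    refine Finset.sum_congr rfl fun x _ => ?_
    rw [mul_left_comm, vertexWeight_mul_avg, ← Finset.mul_sum,
      tsum_eq_sum (s := hD.toFinset) fun y hy => by rw [hg0 y (by simpa using hy), mul_zero]]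
  rw [key f g hg0, key g f hf0, Finset.sum_comm]
  refine Finset.sum_congr rfl fun x _ => Finset.sum_congr rfl fun y _ => ?_
  rw [Γ.weight_symm]
  ring

/-- Symmetry of the Green density. -/
theorem IsGreen.symm {D : Set V} (hD : D.Finite) {a b : V} (ha : a ∈ D) (hb : b ∈ D)
    {γ η : V → ℝ} (hγ : Γ.IsGreen D a γ) (hη : Γ.IsGreen D b η) : γ b = η a := by
  -- Pairing with `γ - Pγ` evaluates at the pole: the normalisation `1/μ(a)` cancels the weight.
  -- Self-adjointness of `P` then gives the symmetry.
  have key : ∀ {a : V} {γ η : V → ℝ}, a ∈ D → Γ.IsGreen D a γ →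
      ∑ x ∈ hD.toFinset, Γ.vertexWeight x * (η x * (γ x - Γ.avg γ x)) = η a := by
    intro a γ η ha hγ
    rw [Finset.sum_eq_single a]
    · rw [hγ.2.1]
      have := (Γ.vertexWeight_pos a).ne'
      field_simp
    · intro x hx hxa
      rw [hγ.1 x (by simpa using hx) hxa]
      ring
    · intro h
      exact absurd (by simpa using ha) h
  rw [← key (η := γ) hb hη, ← key (η := η) ha hγ]
  have := sum_mul_avg_comm (Γ := Γ) hD hγ.2.2 hη.2.2
  simp only [mul_sub, Finset.sum_sub_distrib, this]
  congr 1
  exact Finset.sum_congr rfl fun x _ => by ring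

end Potential

end WeightedGraph

namespace WeightedGraph

/-! ### Geodesics, balls and Harnack chains. -/

section Geometry

variable {V : Type*} {Γ : WeightedGraph V}

theorem d_self (x : V) : Γ.d x x = 0 := SimpleGraph.dist_self

theorem d_comm (x y : V) : Γ.d x y = Γ.d y x := SimpleGraph.dist_comm

theorem d_triangle (x y z : V) : Γ.d x z ≤ Γ.d x y + Γ.d y z := Γ.connected.dist_triangle

theorem eq_of_d_eq_zero {x y : V} (h : Γ.d x y = 0) : x = y :=
  (Γ.connected.dist_eq_zero_iff).1 h

theorem d_le_one {x y : V} (h : Γ.graph.Adj x y) : Γ.d x y ≤ 1 :=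
  (SimpleGraph.dist_eq_one_iff_adj.2 h).le

theorem adj_of_d_eq_one {x y : V} (h : Γ.d x y = 1) : Γ.graph.Adj x y :=
  SimpleGraph.dist_eq_one_iff_adj.1 h

/-- The three pieces of the walk have lengths at most `i`, `j - i` and `d(x,y) - j`; the triangle
inequality forces equality. -/
theorem d_getVert {x y : V} {p : Γ.graph.Walk x y} (hp : p.length = Γ.d x y) {i j : ℕ}
    (hij : i ≤ j) (hj : j ≤ Γ.d x y) : Γ.d (p.getVert i) (p.getVert j) = j - i := by
  have h1 : Γ.d x (p.getVert i) ≤ i :=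
    (SimpleGraph.dist_le (p.take i)).trans (by rw [p.take_length]; exact min_le_left _ _)
  have h2 : Γ.d (p.getVert j) y ≤ Γ.d x y - j :=
    (SimpleGraph.dist_le (p.drop j)).trans (by rw [p.drop_length, hp])
  have h3 : Γ.d (p.getVert i) (p.getVert j) ≤ j - i := by
    have h := SimpleGraph.dist_le ((p.drop i).take (j - i))
    rw [SimpleGraph.Walk.take_length, SimpleGraph.Walk.drop_getVert] at h
    rw [show i + (j - i) = j by omega] at h
    exact h.trans (min_le_left _ _)
  have := Γ.d_triangle x (p.getVert i) y
  have := Γ.d_triangle (p.getVert i) (p.getVert j) y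
  omega

theorem exists_between (Γ : WeightedGraph V) {x y : V} {m : ℕ} (hm : m ≤ Γ.d x y) :
    ∃ z, Γ.d x z = m ∧ Γ.d z y = Γ.d x y - m := by
  obtain ⟨p, hp⟩ := Γ.connected.exists_walk_length_eq_dist x y
  have hp' : p.length = Γ.d x y := hp
  have h1 := d_getVert hp' (Nat.zero_le m) hm
  have h2 := d_getVert hp' hm le_rfl
  rw [p.getVert_zero] at h1
  rw [← hp', p.getVert_length, hp'] at h2
  exact ⟨p.getVert m, by simpa using h1, h2⟩

/-- The open ball with integer radius. -/
def nball (Γ : WeightedGraph V) (x : V) (r : ℕ) : Set V := {v | Γ.d x v < r}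

theorem mem_nball {x v : V} {r : ℕ} : v ∈ Γ.nball x r ↔ Γ.d x v < r := Iff.rfl

theorem nball_subset_ball {x : V} {r : ℕ} {R : ℝ} (h : (r : ℝ) ≤ R) : Γ.nball x r ⊆ Γ.ball x R :=
  fun v hv => by
    have : (Γ.d x v : ℝ) < r := by exact_mod_cast mem_nball.1 hv
    exact this.trans_le h

theorem LocallyFinite.finite_nball (hf : Γ.LocallyFinite) (x : V) (r : ℕ) :
    (Γ.nball x r).Finite := by
  induction r with
  | zero => simp [nball]
  | succ r ih =>
    refine ((Set.finite_singleton x).union (ih.biUnion fun y _ => hf y)).subset ?_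
    intro v hv
    rw [mem_nball] at hv
    rcases Nat.eq_zero_or_pos (Γ.d x v) with h | h
    · exact Or.inl (eq_of_d_eq_zero h).symm
    · obtain ⟨u, hu, huv⟩ := Γ.exists_between (x := x) (y := v) (m := Γ.d x v - 1) (by omega)
      refine Or.inr (Set.mem_biUnion (x := u) ?_ (adj_of_d_eq_one (by omega)))
      rw [mem_nball]
      omega

theorem LocallyFinite.finite_ball (hf : Γ.LocallyFinite) (x : V) (R : ℝ) :
    (Γ.ball x R).Finite := by
  refine (hf.finite_nball x (⌈R⌉₊)).subset fun v hv => ?_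
  rw [mem_nball, Nat.lt_ceil]
  exact hv

/-- Points at distance at most `ρ` have comparable values, with constant `C`, for every nonnegative
function harmonic on the ball of radius `4ρ`. -/
def HarnackStep (Γ : WeightedGraph V) (C : ℝ) : Prop :=
  1 ≤ C ∧ ∀ ρ : ℕ, 1 ≤ ρ → ∀ f : V → ℝ, (∀ v, 0 ≤ f v) → ∀ a b, Γ.d a b ≤ ρ →
    (∀ v, Γ.d a v < 4 * ρ → Γ.avg f v = f v) → f a ≤ C * f b ∧ f b ≤ C * f a

theorem EllipticHarnack.exists_harnackStep (hH : Γ.EllipticHarnack) (hf : Γ.LocallyFinite) :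
    ∃ C, Γ.HarnackStep C := by
  obtain ⟨C, -, hC⟩ := hH
  refine ⟨max C 1, le_max_right _ _, fun ρ hρ f hf0 a b hab hharm => ?_⟩
  have hρ' : (1 : ℝ) ≤ ρ := by exact_mod_cast hρ
  have key := hC a (2 * ρ) (by linarith) f (fun y _ => hf0 y)
    (hf.harmonicOn_iff.2 fun v hv => hharm v (by
      have : (Γ.d a v : ℝ) < 2 * (2 * ρ) := hv
      have : (Γ.d a v : ℝ) < ((4 * ρ : ℕ) : ℝ) := by push_cast; linarith
      exact_mod_cast this))
  have ha : a ∈ Γ.ball a (2 * ρ) := by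
    change (Γ.d a a : ℝ) < 2 * ρ
    rw [d_self]
    push_cast
    linarith
  have hb : b ∈ Γ.ball a (2 * ρ) := by
    change (Γ.d a b : ℝ) < 2 * ρ
    have : (Γ.d a b : ℝ) ≤ ρ := by exact_mod_cast hab
    linarith
  exact ⟨(key a ha b hb).trans (mul_le_mul_of_nonneg_right (le_max_left _ _) (hf0 b)),
    (key b hb a ha).trans (mul_le_mul_of_nonneg_right (le_max_left _ _) (hf0 a))⟩

/-- Harnack chain along geodesics. -/
theorem HarnackStep.chain {C : ℝ} (hC : Γ.HarnackStep C) {ρ : ℕ} (hρ : 1 ≤ ρ) {f : V → ℝ}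
    (hf0 : ∀ v, 0 ≤ f v) (m : ℕ) {a b : V} (hab : Γ.d a b ≤ m * ρ)
    (hharm : ∀ u, Γ.d a u + Γ.d u b = Γ.d a b → ∀ v, Γ.d u v < 4 * ρ → Γ.avg f v = f v) :
    f a ≤ C ^ m * f b ∧ f b ≤ C ^ m * f a := by
  have hC0 : 0 ≤ C := zero_le_one.trans hC.1
  induction m generalizing a with
  | zero =>
    have := eq_of_d_eq_zero (x := a) (y := b) (by simpa using hab)
    subst this
    simp
  | succ m ih =>
    obtain ⟨z, haz, hzb⟩ := Γ.exists_between (x := a) (y := b) (min_le_right ρ (Γ.d a b))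
    rw [add_mul, one_mul] at hab
    have h1 := hC.2 ρ hρ f hf0 a z (haz.trans_le (min_le_left _ _))
      (hharm a (by rw [d_self, zero_add]))
    have h2 := ih (a := z) (by omega) fun u hu => hharm u (by
      have := Γ.d_triangle a z u
      have := Γ.d_triangle a u b
      omega)
    constructor
    · calc f a ≤ C * f z := h1.1
        _ ≤ C * (C ^ m * f b) := mul_le_mul_of_nonneg_left h2.1 hC0
        _ = C ^ (m + 1) * f b := by ring
    · calc f b ≤ C ^ m * f z := h2.2
        _ ≤ C ^ m * (C * f a) := mul_le_mul_of_nonneg_left h1.2 (pow_nonneg hC0 m)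
        _ = C ^ (m + 1) * f a := by ring

/-- Comparison with the value at the centre of a ball. -/
theorem HarnackStep.center {C : ℝ} (hC : Γ.HarnackStep C) {ρ : ℕ} (hρ : 1 ≤ ρ) {f : V → ℝ}
    (hf0 : ∀ v, 0 ≤ f v) (m : ℕ) {a b : V} (hab : Γ.d a b ≤ m * ρ)
    (hharm : ∀ v, Γ.d a v < m * ρ + 4 * ρ → Γ.avg f v = f v) :
    f a ≤ C ^ m * f b ∧ f b ≤ C ^ m * f a :=
  hC.chain hρ hf0 m hab fun u hu v huv => hharm v (by
    have := Γ.d_triangle a u v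
    omega)

/-! ### Comparison of Green densities away from the pole. -/

variable [Infinite V]

/-- The Harnack balls of radius `4ρ` along the geodesics must stay in `D` and miss the pole. -/
theorem IsGreen.chain {C : ℝ} (hC : Γ.HarnackStep C) (hf : Γ.LocallyFinite) {D : Set V}
    (hD : D.Finite) {b : V} {γ : V → ℝ} (hγ : Γ.IsGreen D b γ) {ρ : ℕ} (hρ : 1 ≤ ρ) (m : ℕ)
    {a c : V} (hac : Γ.d a c ≤ m * ρ)
    (hu : ∀ u, Γ.d a u + Γ.d u c = Γ.d a c → 4 * ρ ≤ Γ.d u b ∧ ∀ v, Γ.d u v < 4 * ρ → v ∈ D) :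
    γ a ≤ C ^ m * γ c ∧ γ c ≤ C ^ m * γ a :=
  hC.chain hρ (hγ.nonneg hf hD) m hac fun u hu' v huv => hγ.1 v ((hu u hu').2 v huv) fun h => by
    have := (hu u hu').1
    subst h
    omega

/-- Values of the Green density at points away from the pole are comparable. -/
theorem IsGreen.le_of_away {C : ℝ} (hC : Γ.HarnackStep C) (hf : Γ.LocallyFinite) {D : Set V}
    (hD : D.Finite) {z : V} {γ : V → ℝ} (hγ : Γ.IsGreen D z γ) {ρ : ℕ} (hρ : 1 ≤ ρ) {m : ℕ}
    (hm : 24 ≤ m) (hDz : Γ.nball z (m * ρ + 4 * ρ) ⊆ D) {a w : V}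
    (ha : 16 * ρ ≤ Γ.d a z) (ha' : Γ.d a z ≤ m * ρ) (hw : 16 * ρ ≤ Γ.d w z)
    (hw' : Γ.d w z ≤ m * ρ) : γ a ≤ C ^ (2 * m + 32) * γ w := by
  have hC0 : 0 ≤ C := zero_le_one.trans hC.1
  have hmρ : 24 * ρ ≤ m * ρ := Nat.mul_le_mul_right ρ hm
  have hmem : ∀ {v}, Γ.d z v < m * ρ + 4 * ρ → v ∈ D := fun hv => hDz hv
  -- Moving towards the pole along a geodesic reduces both points to the sphere of radius `16ρ`.
  have radial : ∀ b, 16 * ρ ≤ Γ.d b z → Γ.d b z ≤ m * ρ → ∃ b', Γ.d b' z = 16 * ρ ∧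
      γ b ≤ C ^ m * γ b' ∧ γ b' ≤ C ^ m * γ b := by
    intro b hb hb'
    obtain ⟨b', h1, h2⟩ := Γ.exists_between (x := b) (y := z) (m := Γ.d b z - 16 * ρ) (by omega)
    refine ⟨b', by omega, hγ.chain hC hf hD hρ m (by omega) fun u hu => ⟨?_, fun v hv => ?_⟩⟩
    · have := Γ.d_triangle b u z
      omega
    · have := Γ.d_triangle u b' z
      have := Γ.d_triangle z u v
      have := Γ.d_comm z u
      exact hmem (by omega)
  obtain ⟨a', ha'z, haa', -⟩ := radial a ha ha'
  obtain ⟨w', hw'z, -, hww'⟩ := radial w hw hw'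
  -- Nearby points on the sphere are joined directly. For distant ones a geodesic may pass the pole,
  -- so symmetry moves the pole: with `η`, `θ` having poles `a'`, `w'`, the chain is `γ a' = η z ≲ η
  -- w' = θ a' ≲ θ z = γ w'`.
  have core : γ a' ≤ C ^ 32 * γ w' := by
    rcases lt_or_ge (Γ.d a' w') (8 * ρ) with hlt | hge
    · have h := (hγ.chain hC hf hD hρ 8 (a := a') (c := w') hlt.le fun u hu =>
        ⟨by have := Γ.d_triangle a' u z; omega, fun v hv => hmem (by
          have := Γ.d_triangle z a' u
          have := Γ.d_triangle z u v
          have := Γ.d_comm z a'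
          omega)⟩).1
      exact h.trans (mul_le_mul_of_nonneg_right (pow_le_pow_right₀ hC.1 (by norm_num))
        (hγ.nonneg hf hD w'))
    · have hzD : z ∈ D := hmem (by rw [d_self]; omega)
      have ha'D : a' ∈ D := hmem (by rw [d_comm]; omega)
      have hw'D : w' ∈ D := hmem (by rw [d_comm]; omega)
      obtain ⟨η, hη⟩ := hf.exists_isGreen hD ha'D
      obtain ⟨θ, hθ⟩ := hf.exists_isGreen hD hw'D
      have side : ∀ p q : V, ∀ ξ : V → ℝ, Γ.IsGreen D p ξ → Γ.d p z = 16 * ρ → Γ.d q z = 16 * ρ →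
          8 * ρ ≤ Γ.d p q → ξ z ≤ C ^ 16 * ξ q ∧ ξ q ≤ C ^ 16 * ξ z := by
        intro p q ξ hξ hp hq hpq
        -- For `u` between `z` and `q`, `d(p,u)` is at least `16ρ - d(u,z)` and `8ρ - d(u,q)`.
        -- Adding, `2 d(p,u) ≥ 24ρ - 16ρ`, exactly the required `4ρ`.
        refine hξ.chain hC hf hD hρ 16 (by rw [d_comm]; omega) fun u hu =>
          ⟨?_, fun v hv => hmem ?_⟩
        · have := Γ.d_triangle p u z
          have := Γ.d_triangle p u q
          have := Γ.d_comm u p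
          have := Γ.d_comm u z
          have := Γ.d_comm z q
          omega
        · have := Γ.d_triangle z u v
          have := Γ.d_comm z q
          omega
      have h1 := (side a' w' η hη ha'z hw'z hge).1
      have h2 := (side w' a' θ hθ hw'z ha'z (by rw [d_comm]; exact hge)).2
      rw [hγ.symm hD hzD ha'D hη, hγ.symm hD hzD hw'D hθ]
      rw [hη.symm hD ha'D hw'D hθ] at h1
      calc η z ≤ C ^ 16 * θ a' := h1
        _ ≤ C ^ 16 * (C ^ 16 * θ z) := mul_le_mul_of_nonneg_left h2 (pow_nonneg hC0 _)
        _ = C ^ 32 * θ z := by ring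
  calc γ a ≤ C ^ m * γ a' := haa'
    _ ≤ C ^ m * (C ^ 32 * (C ^ m * γ w)) := by gcongr; exact core.trans (by gcongr)
    _ = C ^ (2 * m + 32) * γ w := by ring

theorem IsGreen.pos (hf : Γ.LocallyFinite) {D : Set V} (hD : D.Finite) {z : V} {γ : V → ℝ}
    (hγ : Γ.IsGreen D z γ) {r : ℕ} (hr : Γ.nball z r ⊆ D) {v : V} (hv : Γ.d z v < r) :
    0 < γ v := by
  have h0 := hγ.nonneg hf hD
  induction hn : Γ.d z v generalizing v with
  | zero =>
    have := eq_of_d_eq_zero hn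
    subst this
    have h1 := hγ.2.1
    have h2 := avg_nonneg (Γ := Γ) h0 z
    have h3 := inv_pos.2 (Γ.vertexWeight_pos z)
    linarith
  | succ n ih =>
    obtain ⟨u, hu, huv⟩ := Γ.exists_between (x := z) (y := v) (m := n) (by omega)
    have hadj : Γ.graph.Adj v u := (adj_of_d_eq_one (by omega)).symm
    rw [← hγ.1 v (hr hv) (by rintro rfl; rw [d_self] at hn; omega)]
    exact (mul_pos (P_pos hadj) (ih (by omega) hu)).trans_le (hf.P_mul_le_avg h0 v u)

end Geometry

end WeightedGraph

namespace WeightedGraph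

/-! ### Hitting probabilities in bounded time and the chain of balls. -/

section Hitting

variable {V : Type*} (Γ : WeightedGraph V)

open Classical in
/-- The probability of hitting `A` within `k` steps. -/
noncomputable def hitBy (A : Set V) : ℕ → V → ℝ
  | 0, x => if x ∈ A then 1 else 0
  | k + 1, x => if x ∈ A then 1 else Γ.avg (hitBy A k) x

variable {Γ}

theorem hitBy_of_mem {A : Set V} {x : V} (hx : x ∈ A) (k : ℕ) : Γ.hitBy A k x = 1 := by
  cases k <;> simp [hitBy, hx]

theorem hitBy_succ_of_notMem {A : Set V} {x : V} (hx : x ∉ A) (k : ℕ) :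
    Γ.hitBy A (k + 1) x = Γ.avg (Γ.hitBy A k) x := by
  simp [hitBy, hx]

theorem hitBy_nonneg (A : Set V) (k : ℕ) (x : V) : 0 ≤ Γ.hitBy A k x := by
  induction k generalizing x with
  | zero => unfold hitBy; split_ifs <;> norm_num
  | succ k ih =>
    by_cases hx : x ∈ A
    · rw [hitBy_of_mem hx]; norm_num
    · rw [hitBy_succ_of_notMem hx]
      exact avg_nonneg ih x

variable [Infinite V]

theorem LocallyFinite.hitBy_le_one (hf : Γ.LocallyFinite) (A : Set V) (k : ℕ) (x : V) :
    Γ.hitBy A k x ≤ 1 := by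
  induction k generalizing x with
  | zero => unfold hitBy; split_ifs <;> norm_num
  | succ k ih =>
    by_cases hx : x ∈ A
    · rw [hitBy_of_mem hx]
    · rw [hitBy_succ_of_notMem hx]
      exact (hf.avg_mono fun y _ => ih y).trans_eq (avg_const 1 x)

theorem LocallyFinite.avg_hitBy_le (hf : Γ.LocallyFinite) (A : Set V) (k : ℕ) (x : V) :
    Γ.avg (Γ.hitBy A k) x ≤ Γ.hitBy A (k + 1) x := by
  by_cases hx : x ∈ A
  · rw [hitBy_of_mem hx]
    exact (hf.avg_mono fun y _ => hf.hitBy_le_one A k y).trans_eq (avg_const 1 x)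
  · rw [hitBy_succ_of_notMem hx]

/-- Following a geodesic. -/
theorem LocallyFinite.pow_le_hitBy (hf : Γ.LocallyFinite) {p : ℝ} (hp : 0 ≤ p)
    (hP : ∀ x y, Γ.graph.Adj x y → p ≤ Γ.P x y) {A : Set V} (k : ℕ) {x z : V}
    (hz : Γ.d x z ≤ k) (hzA : z ∈ A) : p ^ k ≤ Γ.hitBy A k x := by
  induction k generalizing x with
  | zero =>
    rw [eq_of_d_eq_zero (Nat.le_zero.1 hz), hitBy_of_mem hzA, pow_zero]
  | succ k ih =>
    obtain ⟨w, hw⟩ := Γ.connected.preconnected.exists_adj_of_nontrivial x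
    obtain ⟨u, hxu, hu⟩ : ∃ u, Γ.graph.Adj x u ∧ (Γ.d u z ≤ k ∨ x ∈ A) := by
      rcases Nat.eq_zero_or_pos (Γ.d x z) with h | h
      · exact ⟨w, hw, Or.inr (eq_of_d_eq_zero h ▸ hzA)⟩
      · obtain ⟨u, h1, h2⟩ := Γ.exists_between (x := x) (y := z) (m := 1) h
        exact ⟨u, adj_of_d_eq_one h1, Or.inl (by omega)⟩
    rcases hu with hu | hu
    · calc p ^ (k + 1) = p * p ^ k := pow_succ' p k
        _ ≤ Γ.P x u * Γ.hitBy A k u :=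
          mul_le_mul (hP x u hxu) (ih hu) (pow_nonneg hp k) (Γ.P_nonneg x u)
        _ ≤ _ := (hf.P_mul_le_avg (hitBy_nonneg A k) x u).trans (hf.avg_hitBy_le A k x)
    · rw [hitBy_of_mem hu]
      refine pow_le_one₀ hp ((hP x w hw).trans ?_)
      have := hf.P_mul_le_avg (f := fun _ => 1) (fun _ => zero_le_one) x w
      rwa [avg_const, mul_one] at this

/-- Extension of the lower bound `h - M / (k + 1)` for the hitting probability from the boundary of
a set to the set, where `M` dominates the expected time weighted by `h`. -/
theorem LocallyFinite.sub_div_le_hitBy (hf : Γ.LocallyFinite) {A G : Set V} {h M : V → ℝ}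
    (hM0 : ∀ w, 0 ≤ M w) (hh : ∀ w ∈ G, h w ≤ Γ.avg h w)
    (hM : ∀ w ∈ G, Γ.avg M w + h w ≤ M w)
    (hbd : ∀ w ∈ G, ∀ y ∉ G, Γ.graph.Adj w y →
      ∀ k : ℕ, h y - M y / (k + 1) ≤ Γ.hitBy A k y) (k : ℕ) :
    ∀ w ∈ G, h w - M w / (k + 1) ≤ Γ.hitBy A k w := by
  induction k with
  | zero =>
    intro w hw
    have h1 := hM w hw
    have h2 := avg_nonneg (Γ := Γ) hM0 w
    have h3 := hitBy_nonneg (Γ := Γ) A 0 w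
    simp only [Nat.cast_zero, zero_add, div_one]
    linarith
  | succ k ih =>
    intro w hw
    have hk : (0 : ℝ) < k + 1 := by positivity
    have h1 : Γ.avg (fun y => h y - (1 / ((k : ℝ) + 1)) * M y) w ≤ Γ.hitBy A (k + 1) w := by
      refine (hf.avg_mono fun y hy => ?_).trans (hf.avg_hitBy_le A k w)
      rw [one_div_mul_eq_div]
      by_cases hyG : y ∈ G
      · exact ih y hyG
      · exact hbd w hw y hyG hy k
    rw [hf.avg_sub, avg_mul_left, one_div_mul_eq_div] at h1
    have h2 : Γ.avg M w / (k + 1) ≤ (M w - h w) / (k + 1) := by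
      gcongr
      linarith [hM w hw]
    have h3 := hh w hw
    push_cast
    -- In the first case one step of time buys the improvement from `k + 1` to `k + 2`; in the
    -- second the claimed lower bound is not positive.
    rcases le_total (M w) ((k + 2) * h w) with h4 | h4
    · have : (M w - h w) / (k + 1) ≤ M w / (k + 1 + 1) := by
        rw [div_le_div_iff₀ hk (by positivity)]
        nlinarith
      linarith
    · have : h w ≤ M w / (k + 1 + 1) := by
        rw [le_div_iff₀ (by positivity)]
        linarith
      linarith [hitBy_nonneg (Γ := Γ) A (k + 1) w]

/-- One step of the chain of balls: a lower bound for the hitting probability near `z` is carried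
over to a neighbourhood of `x`. -/
theorem HarnackStep.hitBy_step {C : ℝ} (hC : Γ.HarnackStep C) (hf : Γ.LocallyFinite) {ρ : ℕ}
    (hρ : 1 ≤ ρ) {A : Set V} {x z : V} (hxz : Γ.d x z = 42 * ρ) {h' : V → ℝ}
    (h'0 : ∀ v, 0 ≤ h' v) (h'harm : ∀ v, Γ.d z v < 25 * ρ → Γ.avg h' v = h' v) {e' : V → ℝ}
    (he' : Γ.IsExit (Γ.nball z (21 * ρ)) e') {β E : ℝ} (hβ : 0 ≤ β)
    (hval : ∀ k : ℕ, ∀ w, Γ.d z w < 17 * ρ →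
      h' w - (C ^ 21 * h' z * e' w + β * h' w) / (k + 1) ≤ Γ.hitBy A k w)
    {e : V → ℝ} (he : Γ.IsExit (Γ.nball x (100 * ρ)) e) (hE : e x ≤ E) {e₀ : V → ℝ}
    (he₀ : Γ.IsExit (Γ.nball x (21 * ρ)) e₀) :
    ∃ h : V → ℝ, (∀ v, 0 ≤ h v) ∧ (∀ v, Γ.d x v < 25 * ρ → Γ.avg h v = h v) ∧
      h' z ≤ C ^ 137 * h x ∧ ∀ k : ℕ, ∀ w, Γ.d x w < 17 * ρ →
        h w - (C ^ 21 * h x * e₀ w + (β + C ^ 196 * E) * h w) / (k + 1) ≤ Γ.hitBy A k w := by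
  classical
  have hC0 : 0 ≤ C := zero_le_one.trans hC.1
  have hDfin := hf.finite_nball x (100 * ρ)
  set D := Γ.nball x (100 * ρ) with hDdef
  set B := Γ.nball z (17 * ρ) with hBdef
  have he0 := he.nonneg hf hDfin
  have he'0 := he'.nonneg hf (hf.finite_nball z (21 * ρ))
  have he₀0 := he₀.nonneg hf (hf.finite_nball x (21 * ρ))
  have hGfin : (D \ B).Finite := hDfin.subset Set.sdiff_subset
  -- `h` is the expected value of `h'` at the entrance to `B`, counted only if the walk enters `B`
  -- before leaving `D`.
  obtain ⟨h, hharm, hout⟩ := hf.exists_dirichlet hGfin (fun _ => 0)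
    fun v => if v ∈ B then h' v else 0
  have hB : ∀ v ∈ B, h v = h' v := fun v hv => by
    rw [hout v fun hvG => hvG.2 hv, if_pos hv]
  have hBD : ∀ v, v ∈ B → v ∈ D := fun v hv => by
    rw [hBdef, mem_nball] at hv
    rw [hDdef, mem_nball]
    have := Γ.d_triangle x z v
    omega
  have hD : ∀ v ∉ D, h v = 0 := fun v hv => by
    rw [hout v fun hvG => hv hvG.1, if_neg fun hvB => hv (hBD v hvB)]
  have hG : ∀ v, v ∈ D → v ∉ B → Γ.avg h v = h v := fun v h1 h2 => by
    linarith [hharm v ⟨h1, h2⟩]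
  have hboundary : ∀ {v}, v ∉ D \ B → v ∈ B ∨ v ∉ D := fun {v} hv => by
    by_cases h1 : v ∈ B
    · exact Or.inl h1
    · exact Or.inr fun h2 => hv ⟨h2, h1⟩
  have h0 : ∀ v, 0 ≤ h v := by
    have hb : ∀ v ∉ D \ B, 0 ≤ h v := fun v hv => by
      rcases hboundary hv with h1 | h1
      · rw [hB v h1]; exact h'0 v
      · rw [hD v h1]
    intro v
    by_cases hv : v ∈ D \ B
    · exact hf.nonneg_of_superharmonic hGfin (fun y hy => (hG y hy.1 hy.2).le)
        (fun y _ w hw _ => hb w hw) v hv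
    · exact hb v hv
  have h'near : ∀ v ∈ B, h' z ≤ C ^ 21 * h' v ∧ h' v ≤ C ^ 21 * h' z := fun v hv => by
    rw [hBdef, mem_nball] at hv
    exact hC.center hρ h'0 21 (by omega) fun u hu => h'harm u (by omega)
  have hle : ∀ v, h v ≤ C ^ 21 * h' z := by
    have hb : ∀ v ∉ D \ B, h v ≤ C ^ 21 * h' z := fun v hv => by
      rcases hboundary hv with h1 | h1
      · rw [hB v h1]; exact (h'near v h1).2
      · rw [hD v h1]; exact mul_nonneg (pow_nonneg hC0 _) (h'0 z)
    intro v
    by_cases hv : v ∈ D \ B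
    · refine hf.le_of_boundary_le hGfin (g := fun _ => C ^ 21 * h' z) (fun y hy => ?_)
        (fun y _ w hw _ => hb w hw) v hv
      rw [avg_const, hG y hy.1 hy.2]
      simp
    · exact hb v hv
  have hxD : x ∈ D := by
    rw [hDdef, mem_nball, d_self]; omega
  have hxB : x ∉ B := by
    rw [hBdef, mem_nball, d_comm]; omega
  have hzB : z ∈ B := by
    rw [hBdef, mem_nball, d_self]; omega
  -- The spacing is `42 = 25 + 17`: radius `17` for the target, `25 = 21 + 4` for Harnack up to
  -- distance `21ρ`, and `21 = 17 + 4` for Harnack up to distance `17ρ` inside `B'`.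
  have hnearG : ∀ v, Γ.d x v < 25 * ρ → v ∈ D ∧ v ∉ B := fun v hv => by
    rw [hDdef, hBdef, mem_nball, mem_nball]
    have := Γ.d_triangle x v z
    have := Γ.d_comm z v
    constructor <;> omega
  have hharmx : ∀ v, Γ.d x v < 25 * ρ → Γ.avg h v = h v := fun v hv =>
    hG v (hnearG v hv).1 (hnearG v hv).2
  have hxnear : ∀ v, Γ.d x v ≤ 21 * ρ → h x ≤ C ^ 21 * h v ∧ h v ≤ C ^ 21 * h x := fun v hv =>
    hC.center hρ h0 21 hv fun u hu => hharmx u (by omega)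
  -- Compare `h` with the Green density of pole `z`: on the boundary of `B`, `h' z * γ` is at most
  -- `C^(21+116) γ(x) h`, and outside `D` both vanish. Evaluating at `x` cancels `γ x > 0`.
  have hlow : h' z ≤ C ^ 137 * h x := by
    obtain ⟨γ, hγ⟩ := hf.exists_isGreen hDfin (hBD z hzB)
    have hzD : Γ.nball z (42 * ρ + 4 * ρ) ⊆ D := fun v hv => by
      rw [mem_nball] at hv
      rw [hDdef, mem_nball]
      have := Γ.d_triangle x z v
      omega
    have hγx : 0 < γ x := hγ.pos hf hDfin hzD (by rw [d_comm]; omega)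
    have hγ0 := hγ.nonneg hf hDfin
    have key := hf.le_of_boundary_le hGfin (f := fun w => h' z * γ w)
      (g := fun w => (C ^ 137 * γ x) * h w) (fun w hw => by
        rw [avg_mul_left, avg_mul_left, hG w hw.1 hw.2,
          hγ.1 w hw.1 (by rintro rfl; exact hw.2 hzB)]
        simp) (fun w hw y hy hwy => by
        rcases hboundary hy with h1 | h1
        · have h2 : 17 * ρ ≤ Γ.d z w := not_lt.1 fun h => hw.2 h
          have h3 := Γ.d_triangle z y w
          have h4 := d_le_one hwy.symm
          have h5 : Γ.d z y < 17 * ρ := h1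
          have h6 := hγ.le_of_away hC hf hDfin hρ (m := 42) (by norm_num) hzD (a := y) (w := x)
            (by rw [d_comm]; omega) (by rw [d_comm]; omega) (by omega) (by omega)
          rw [hB y h1]
          calc h' z * γ y ≤ (C ^ 21 * h' y) * (C ^ (2 * 42 + 32) * γ x) :=
                mul_le_mul (h'near y h1).1 h6 (hγ0 y) (mul_nonneg (pow_nonneg hC0 _) (h'0 y))
            _ = C ^ 137 * γ x * h' y := by ring
        · rw [hγ.2.2 y h1, hD y h1]; simp) x ⟨hxD, hxB⟩
    exact le_of_mul_le_mul_right (by linarith) hγx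
  have hη0 : 0 ≤ C ^ 21 * h' z := mul_nonneg (pow_nonneg hC0 _) (h'0 z)
  -- The exit time `e` pays for the time spent in `D \ B`, since `h ≤ C^21 h' z` there; on `B` it
  -- dominates the leftover `e'` of the previous link.
  have hval1 : ∀ k : ℕ, ∀ w,
      h w - (C ^ 21 * h' z * e w + β * h w) / (k + 1) ≤ Γ.hitBy A k w := by
    have hb : ∀ w ∉ D \ B, ∀ k : ℕ,
        h w - (C ^ 21 * h' z * e w + β * h w) / (k + 1) ≤ Γ.hitBy A k w := by
      intro w hw k
      rcases hboundary hw with h1 | h1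
      · refine le_trans ?_ (hval k w h1)
        have hmono : e' w ≤ e w := he'.mono hf hDfin (fun v hv => by
          rw [mem_nball] at hv
          rw [hDdef, mem_nball]
          have := Γ.d_triangle x z v
          omega) he w
        rw [hB w h1]
        gcongr
      · rw [hD w h1, he.2 w h1]
        simpa using hitBy_nonneg A k w
    intro k w
    by_cases hw : w ∈ D \ B
    · refine hf.sub_div_le_hitBy
        (fun w => add_nonneg (mul_nonneg hη0 (he0 w)) (mul_nonneg hβ (h0 w)))
        (fun w hw => (hG w hw.1 hw.2).ge) (fun w hw => ?_) (fun _ _ y hy _ => hb y hy) k w hw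
      rw [hf.avg_add, avg_mul_left, avg_mul_left, hG w hw.1 hw.2]
      have h1 := he.1 w hw.1
      have h2 : Γ.avg e w = e w - 1 := by linarith
      rw [h2]
      linarith [hle w]
    · exact hb w hw k
  set B' := Γ.nball x (21 * ρ) with hB'def
  have hB'fin : B'.Finite := hf.finite_nball x (21 * ρ)
  -- Only `e x` is bounded, and `e` is not harmonic. Inside `B'` it is replaced by its harmonic
  -- extension `g`, to which Harnack applies, and the time spent in `B'` is charged to `e₀`.
  obtain ⟨g, hgharm, hgout⟩ := hf.exists_dirichlet hB'fin (fun _ => 0) e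
  have hB'D : ∀ v ∈ B', v ∈ D := fun v hv => by
    rw [hB'def, mem_nball] at hv
    rw [hDdef, mem_nball]
    omega
  have hg0 : ∀ v, 0 ≤ g v := fun v => by
    by_cases hv : v ∈ B'
    · exact hf.nonneg_of_superharmonic hB'fin (fun y hy => by linarith [hgharm y hy])
        (fun y _ w hw _ => by rw [hgout w hw]; exact he0 w) v hv
    · rw [hgout v hv]; exact he0 v
  have hgx : g x ≤ E := by
    refine le_trans ?_ hE
    refine hf.le_of_boundary_le hB'fin (fun y hy => ?_)
      (fun y _ w hw _ => (hgout w hw).le) x (by rw [hB'def, mem_nball, d_self]; omega)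
    rw [hgharm y hy, he.1 y (hB'D y hy)]
    norm_num
  have hηx : 0 ≤ C ^ 21 * h x := mul_nonneg (pow_nonneg hC0 _) (h0 x)
  have hval2 : ∀ k : ℕ, ∀ w ∈ B', h w -
      (C ^ 21 * h x * e₀ w + (C ^ 21 * h' z * g w + β * h w)) / (k + 1) ≤ Γ.hitBy A k w := by
    refine fun k => hf.sub_div_le_hitBy
      (M := fun w => C ^ 21 * h x * e₀ w + (C ^ 21 * h' z * g w + β * h w)) (fun w => ?_)
      (fun w hw => (hharmx w ?_).ge) (fun w hw => ?_) (fun w _ y hy _ k => ?_) k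
    · exact add_nonneg (mul_nonneg hηx (he₀0 w))
        (add_nonneg (mul_nonneg hη0 (hg0 w)) (mul_nonneg hβ (h0 w)))
    · rw [hB'def, mem_nball] at hw
      omega
    · have hw' : Γ.d x w < 21 * ρ := hw
      rw [hf.avg_add, hf.avg_add, avg_mul_left, avg_mul_left, avg_mul_left,
        hharmx w (by omega)]
      have h1 : Γ.avg e₀ w = e₀ w - 1 := by linarith [he₀.1 w hw]
      have h2 : Γ.avg g w = g w := by linarith [hgharm w hw]
      rw [h1, h2]
      linarith [(hxnear w hw'.le).2]
    · simp only [he₀.2 y hy, hgout y hy, mul_zero, zero_add]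
      exact hval1 k y
  refine ⟨h, h0, hharmx, hlow, fun k w hw => le_trans ?_ (hval2 k w ?_)⟩
  · have h1 : g w ≤ C ^ 17 * g x :=
      (hC.center hρ hg0 17 hw.le fun u hu => by
        linarith [hgharm u (by rw [hB'def, mem_nball]; omega)]).2
    have h2 := (hxnear w (by omega)).1
    -- `196 = 21 + 137 + 21 + 17`.
    have h3 : C ^ 21 * h' z * g w ≤ C ^ 196 * E * h w := by
      calc C ^ 21 * h' z * g w ≤ C ^ 21 * (C ^ 137 * (C ^ 21 * h w)) * (C ^ 17 * E) := by
            have hh : h' z ≤ C ^ 137 * (C ^ 21 * h w) :=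
              hlow.trans (mul_le_mul_of_nonneg_left h2 (pow_nonneg hC0 _))
            exact mul_le_mul (mul_le_mul_of_nonneg_left hh (pow_nonneg hC0 _))
              (h1.trans (mul_le_mul_of_nonneg_left hgx (pow_nonneg hC0 _))) (hg0 w)
              (mul_nonneg (pow_nonneg hC0 _) ((h'0 z).trans hh))
        _ = C ^ 196 * E * h w := by ring
    gcongr
    linarith
  · rw [hB'def, mem_nball]
    omega

/-- Lower bound for the hitting probability along a chain of balls. -/
theorem HarnackStep.hitBy_chain {C : ℝ} (hC : Γ.HarnackStep C) (hf : Γ.LocallyFinite) {ρ : ℕ}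
    (hρ : 1 ≤ ρ) {A : Set V} {E : ℝ} (L : ℕ) (xs : ℕ → V)
    (hxs : ∀ i < L, Γ.d (xs i) (xs (i + 1)) = 42 * ρ)
    (hE : ∀ i ≤ L, ∀ e, Γ.IsExit (Γ.nball (xs i) (100 * ρ)) e → e (xs i) ≤ E)
    (hA : Γ.nball (xs L) (17 * ρ) ⊆ A) {e₀ : V → ℝ}
    (he₀ : Γ.IsExit (Γ.nball (xs 0) (21 * ρ)) e₀) :
    ∃ h : V → ℝ, (∀ v, 0 ≤ h v) ∧ (∀ v, Γ.d (xs 0) v < 25 * ρ → Γ.avg h v = h v) ∧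
      1 ≤ (C ^ 137) ^ L * h (xs 0) ∧ ∀ k : ℕ, ∀ w, Γ.d (xs 0) w < 17 * ρ →
        h w - (C ^ 21 * h (xs 0) * e₀ w + (L * (C ^ 196 * E)) * h w) / (k + 1) ≤
          Γ.hitBy A k w := by
  have hC0 : 0 ≤ C := zero_le_one.trans hC.1
  have hE0 : 0 ≤ E := by
    obtain ⟨e, he⟩ := hf.exists_isExit (hf.finite_nball (xs 0) (100 * ρ))
    exact (he.nonneg hf (hf.finite_nball _ _) _).trans (hE 0 (Nat.zero_le L) e he)
  induction L generalizing xs e₀ with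
  | zero =>
    refine ⟨fun _ => 1, fun _ => zero_le_one, fun v _ => avg_const 1 v, by simp, fun k w hw => ?_⟩
    rw [hitBy_of_mem (hA hw)]
    have := he₀.nonneg hf (hf.finite_nball _ _) w
    have : 0 ≤ (C ^ 21 * 1 * e₀ w + (((0 : ℕ) : ℝ) * (C ^ 196 * E)) * 1) / ((k : ℝ) + 1) := by
      positivity
    linarith
  | succ L ih =>
    obtain ⟨e', he'⟩ := hf.exists_isExit (hf.finite_nball (xs 1) (21 * ρ))
    obtain ⟨e, he⟩ := hf.exists_isExit (hf.finite_nball (xs 0) (100 * ρ))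
    obtain ⟨h', h'0, h'harm, h'1, h'val⟩ := ih (fun i => xs (i + 1))
      (fun i hi => hxs (i + 1) (by omega)) (fun i hi => hE (i + 1) (by omega)) hA he'
    obtain ⟨h, h0, hharm, hlow, hval⟩ := hC.hitBy_step hf hρ (hxs 0 (by omega)) h'0 h'harm he'
      (by positivity) h'val he (hE 0 (by omega) e he) he₀
    refine ⟨h, h0, hharm, ?_, fun k w hw => ?_⟩
    · calc 1 ≤ (C ^ 137) ^ L * h' (xs 1) := h'1
        _ ≤ (C ^ 137) ^ L * (C ^ 137 * h (xs 0)) :=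
          mul_le_mul_of_nonneg_left hlow (pow_nonneg (pow_nonneg hC0 _) _)
        _ = (C ^ 137) ^ (L + 1) * h (xs 0) := by ring
    · have hcast : ((L + 1 : ℕ) : ℝ) * (C ^ 196 * E) = L * (C ^ 196 * E) + C ^ 196 * E := by
        push_cast
        rw [add_mul, one_mul]
      rw [hcast]
      exact hval k w hw

/-- At the starting point `e₀ ≤ E`, so the condition on `k` makes the time correction at most `h/2`.
-/
theorem HarnackStep.le_hitBy {C : ℝ} (hC : Γ.HarnackStep C) (hf : Γ.LocallyFinite) {ρ : ℕ}
    (hρ : 1 ≤ ρ) {A : Set V} {E : ℝ} (L : ℕ) (xs : ℕ → V)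
    (hxs : ∀ i < L, Γ.d (xs i) (xs (i + 1)) = 42 * ρ)
    (hE : ∀ i ≤ L, ∀ e, Γ.IsExit (Γ.nball (xs i) (100 * ρ)) e → e (xs i) ≤ E)
    (hA : Γ.nball (xs L) (17 * ρ) ⊆ A) {k : ℕ}
    (hk : 2 * ((C ^ 21 + L * C ^ 196) * E) ≤ k + 1) :
    1 / 2 ≤ (C ^ 137) ^ L * Γ.hitBy A k (xs 0) := by
  have hC0 : 0 ≤ C := zero_le_one.trans hC.1
  obtain ⟨e₀, he₀⟩ := hf.exists_isExit (hf.finite_nball (xs 0) (21 * ρ))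
  obtain ⟨e, he⟩ := hf.exists_isExit (hf.finite_nball (xs 0) (100 * ρ))
  obtain ⟨h, h0, -, h1, hval⟩ := hC.hitBy_chain hf hρ L xs hxs hE hA he₀
  have hx := hval k (xs 0) (by rw [d_self]; omega)
  have heE : e₀ (xs 0) ≤ E := (he₀.mono hf (hf.finite_nball _ _) (fun v hv => by
    rw [mem_nball] at hv ⊢
    omega) he _).trans (hE 0 (Nat.zero_le L) e he)
  have hk0 : (0 : ℝ) < k + 1 := by positivity
  have h2 : (C ^ 21 * h (xs 0) * e₀ (xs 0) + (L * (C ^ 196 * E)) * h (xs 0)) / (k + 1) ≤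
      h (xs 0) / 2 := by
    rw [div_le_iff₀ hk0]
    calc C ^ 21 * h (xs 0) * e₀ (xs 0) + (L * (C ^ 196 * E)) * h (xs 0)
        ≤ C ^ 21 * h (xs 0) * E + (L * (C ^ 196 * E)) * h (xs 0) := by
          have := h0 (xs 0)
          gcongr
      _ = h (xs 0) / 2 * (2 * ((C ^ 21 + L * C ^ 196) * E)) := by ring
      _ ≤ h (xs 0) / 2 * (k + 1) := by
          have := h0 (xs 0)
          gcongr
  have h3 : h (xs 0) / 2 ≤ Γ.hitBy A k (xs 0) := by linarith
  calc 1 / 2 ≤ ((C ^ 137) ^ L * h (xs 0)) / 2 := by linarith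
    _ = (C ^ 137) ^ L * (h (xs 0) / 2) := by ring
    _ ≤ _ := by gcongr

end Hitting

end WeightedGraph

namespace WeightedGraph

/-! ### From the law on trajectories to the potential-theoretic quantities. -/

section PathSpace

variable {V : Type*} {Γ : WeightedGraph V}

/-- The trajectories avoiding `A` up to time `k`. -/
def avoiding (A : Set V) (k : ℕ) : Set (ℕ → V) := {ω | ∀ t ≤ k, ω t ∉ A}

theorem measurableSet_avoiding [MeasurableSpace V] [DiscreteMeasurableSpace V] (A : Set V)
    (k : ℕ) : MeasurableSet (avoiding A k) := by
  have : avoiding A k = ⋂ t, ⋂ (_ : t ≤ k), (fun ω : ℕ → V => ω t) ⁻¹' Aᶜ := by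
    ext ω; simp [avoiding]
  rw [this]
  exact .iInter fun t => .iInter fun _ => measurable_pi_apply t .of_discrete

theorem exitTime_le {A : Set V} {ω : ℕ → V} {t : ℕ} (h : ω t ∉ A) : exitTime A ω ≤ t :=
  iInf₂_le t h

theorem le_exitTime {A : Set V} {ω : ℕ → V} {k : ℕ} (h : ∀ t < k, ω t ∈ A) :
    (k : ℕ∞) ≤ exitTime A ω :=
  le_iInf₂ fun t ht => by
    by_contra! hlt
    exact ht (h t (by exact_mod_cast hlt))

theorem LocallyFinite.tendsto_avg (hf : Γ.LocallyFinite) {f : ℕ → V → ℝ} {g : V → ℝ}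
    (h : ∀ y, Filter.Tendsto (fun K => f K y) Filter.atTop (nhds (g y))) (x : V) :
    Filter.Tendsto (fun K => Γ.avg (f K) x) Filter.atTop (nhds (Γ.avg g x)) := by
  have hsum : ∀ u : V → ℝ, Γ.avg u x = ∑ y ∈ (hf x).toFinset, Γ.P x y * u y := fun u =>
    tsum_eq_sum fun y hy => by rw [P_eq_zero (by simpa using hy), zero_mul]
  simp_rw [hsum]
  exact tendsto_finsetSum _ fun y _ => (h y).const_mul _

variable [Infinite V] [MeasurableSpace V]
  [DiscreteMeasurableSpace V]

instance (x : V) : IsProbabilityMeasure (Γ.law x) := by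
  unfold law; infer_instance

theorem integral_stepKernel {g : V → ℝ} {b : ℝ} (hg : ∀ y, |g y| ≤ b) (x : V) :
    ∫ y, g y ∂(Γ.stepKernel x) = Γ.avg g x := by
  change ∫ y, g y ∂(Γ.step x).toMeasure = _
  rw [PMF.integral_eq_tsum]
  · refine tsum_congr fun y => ?_
    change (ENNReal.ofReal (Γ.P x y)).toReal • g y = _
    rw [ENNReal.toReal_ofReal (Γ.P_nonneg x y), smul_eq_mul]
  · exact Integrable.of_bound (Measurable.of_discrete).aestronglyMeasurable b
      (Filter.Eventually.of_forall hg)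

/-- The Markov property of the walk at time `n`. -/
theorem integral_indicator_succ (x : V) (n : ℕ) {S : Set ((i : Finset.Iic n) → V)}
    (hS : MeasurableSet S) {g : V → ℝ} {b : ℝ} (hg : ∀ y, |g y| ≤ b) :
    ∫ ω, S.indicator (fun _ => g (ω (n + 1))) (Preorder.frestrictLe n ω) ∂(Γ.law x) =
      ∫ ω, S.indicator (fun _ => Γ.avg g (ω n)) (Preorder.frestrictLe n ω) ∂(Γ.law x) := by
  have hgm : Measurable g := .of_discrete
  have ham : Measurable (Γ.avg g) := .of_discrete
  let F : ((i : Finset.Iic n) → V) × V → ℝ := fun p => S.indicator (fun _ => g p.2) p.1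
  have hF : Measurable F := by
    have : F = (S ×ˢ Set.univ).indicator fun p => g p.2 := by
      funext p
      by_cases h : p.1 ∈ S <;> simp [F, Set.indicator, h]
    rw [this]
    exact (hgm.comp measurable_snd).indicator (hS.prod .univ)
  have hFb : ∀ p, ‖F p‖ ≤ b := fun p => by
    by_cases h : p.1 ∈ S
    · simpa [F, h] using hg p.2
    · simpa [F, h] using (abs_nonneg _).trans (hg p.2)
  have hmap := Kernel.partialTraj_compProd_eq_map_traj (X := fun _ => V) (κ := Γ.historyKernel)
    (Nat.zero_le n) (x₀ := fun _ => x)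
  have h1 : ∫ ω, F (Preorder.frestrictLe n ω, ω (n + 1)) ∂(Γ.law x) =
      ∫ p, F p ∂((Kernel.partialTraj (X := fun _ => V) Γ.historyKernel 0 n fun _ => x) ⊗ₘ
        Γ.historyKernel n) := by
    rw [hmap, integral_map (by fun_prop) hF.aestronglyMeasurable]
    rfl
  have hint : Integrable F ((Kernel.partialTraj (X := fun _ => V) Γ.historyKernel 0 n fun _ => x) ⊗ₘ
        Γ.historyKernel n) :=
    Integrable.of_bound hF.aestronglyMeasurable b (Filter.Eventually.of_forall hFb)
  have hinner : ∀ h : (i : Finset.Iic n) → V, ∫ y, F (h, y) ∂(Γ.historyKernel n h) =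
      S.indicator (fun _ => Γ.avg g (h ⟨n, Finset.mem_Iic.2 le_rfl⟩)) h := by
    intro h
    have hk : Γ.historyKernel n h = Γ.stepKernel (h ⟨n, Finset.mem_Iic.2 le_rfl⟩) := by
      unfold historyKernel
      rw [Kernel.comap_apply]
    by_cases hh : h ∈ S
    · simp only [F, Set.indicator_of_mem hh, hk]
      exact integral_stepKernel hg _
    · simp [F, hh]
  have hG : Measurable fun h : (i : Finset.Iic n) → V =>
      S.indicator (fun _ => Γ.avg g (h ⟨n, Finset.mem_Iic.2 le_rfl⟩)) h :=
    (ham.comp (measurable_pi_apply _)).indicator hS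
  change ∫ ω, F (Preorder.frestrictLe n ω, ω (n + 1)) ∂(Γ.law x) = _
  rw [h1, Measure.integral_compProd hint]
  simp_rw [hinner]
  have hmap2 : (Γ.law x).map (Preorder.frestrictLe n) =
      Kernel.partialTraj (X := fun _ => V) Γ.historyKernel 0 n fun _ => x :=
    Kernel.traj_map_frestrictLe_apply (X := fun _ => V) (κ := Γ.historyKernel) 0 n _
  rw [← hmap2, integral_map (by fun_prop) hG.aestronglyMeasurable]
  rfl

/-- Keeping `k` free lets the Markov property trade the last step of the path for one more step of
`hitBy`. The case `k = 0` is the avoidance probability. -/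
theorem LocallyFinite.integral_avoiding (hf : Γ.LocallyFinite) (A : Set V) (x : V) (k j : ℕ) :
    ∫ ω, (avoiding A j).indicator (fun ω => 1 - Γ.hitBy A k (ω j)) ω ∂(Γ.law x) =
      1 - Γ.hitBy A (k + j) x := by
  classical
  induction j generalizing k with
  | zero =>
    have hm : Measurable fun ω : ℕ → V => 1 - Γ.hitBy A k (ω 0) :=
      (Measurable.of_discrete (f := fun v => 1 - Γ.hitBy A k v)).comp (measurable_pi_apply 0)
    have h0 : ∀ ω : ℕ → V, (avoiding A 0).indicator (fun ω => 1 - Γ.hitBy A k (ω 0)) ω =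
        1 - Γ.hitBy A k (ω 0) := fun ω => by
      by_cases h : ω 0 ∈ A
      · simp [avoiding, Set.indicator, h, hitBy_of_mem h]
      · simp [avoiding, Set.indicator, h]
    simp_rw [h0]
    unfold law
    rw [Kernel.integral_traj _ hm.aestronglyMeasurable]
    simp [Function.updateFinset]
  | succ j ih =>
    let S : Set ((i : Finset.Iic j) → V) := {h | ∀ t, h t ∉ A}
    have hS : MeasurableSet S := by
      have : S = ⋂ t, (fun h : (i : Finset.Iic j) → V => h t) ⁻¹' Aᶜ := by
        ext h; simp [S]
      rw [this]
      exact .iInter fun t => measurable_pi_apply t .of_discrete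
    have hmem : ∀ ω : ℕ → V, Preorder.frestrictLe j ω ∈ S ↔ ω ∈ avoiding A j := fun ω => by
      simp [S, avoiding]
    have hb : ∀ y, |1 - Γ.hitBy A k y| ≤ 1 := fun y => by
      rw [abs_le]
      constructor <;> linarith [hitBy_nonneg (Γ := Γ) A k y, hf.hitBy_le_one A k y]
    have key := integral_indicator_succ (Γ := Γ) x j hS hb
    have hl : ∀ ω : ℕ → V, S.indicator (fun _ => 1 - Γ.hitBy A k (ω (j + 1)))
        (Preorder.frestrictLe j ω) =
          (avoiding A (j + 1)).indicator (fun ω => 1 - Γ.hitBy A k (ω (j + 1))) ω := by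
      intro ω
      by_cases h : ω ∈ avoiding A j
      · rw [Set.indicator_of_mem ((hmem ω).2 h)]
        by_cases h1 : ω (j + 1) ∈ A
        · rw [Set.indicator_of_notMem fun h2 : ω ∈ avoiding A (j + 1) => h2 (j + 1) le_rfl h1,
            hitBy_of_mem h1, sub_self]
        · rw [Set.indicator_of_mem]
          intro t ht
          rcases Nat.le_succ_iff.1 ht with h2 | h2
          · exact h t h2
          · rwa [h2]
      · rw [Set.indicator_of_notMem (mt (hmem ω).1 h), Set.indicator_of_notMem]
        exact fun h2 => h fun t ht => h2 t (ht.trans j.le_succ)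
    have hr : ∀ ω : ℕ → V, S.indicator (fun _ => Γ.avg (fun v => 1 - Γ.hitBy A k v) (ω j))
        (Preorder.frestrictLe j ω) =
          (avoiding A j).indicator (fun ω => 1 - Γ.hitBy A (k + 1) (ω j)) ω := by
      intro ω
      by_cases h : ω ∈ avoiding A j
      · rw [Set.indicator_of_mem ((hmem ω).2 h), Set.indicator_of_mem h, hf.avg_sub, avg_const,
          hitBy_succ_of_notMem (h j le_rfl)]
      · rw [Set.indicator_of_notMem (mt (hmem ω).1 h), Set.indicator_of_notMem h]
    simp_rw [hl, hr] at key
    rw [key, ih (k + 1), show k + 1 + j = k + (j + 1) by ring]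

theorem LocallyFinite.law_avoiding (hf : Γ.LocallyFinite) (A : Set V) (x : V) (k : ℕ) :
    (Γ.law x).real (avoiding A k) = 1 - Γ.hitBy A k x := by
  have h := hf.integral_avoiding A x 0 k
  have h0 : ∀ ω : ℕ → V, (avoiding A k).indicator (fun ω => 1 - Γ.hitBy A 0 (ω k)) ω =
      (avoiding A k).indicator 1 ω := fun ω => by
    by_cases hω : ω ∈ avoiding A k
    · simp [hω, hitBy, hω k le_rfl]
    · simp [hω]
  simp_rw [h0] at h
  rw [integral_indicator_one (measurableSet_avoiding A k), zero_add] at h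
  exact h

theorem LocallyFinite.hitBy_le_hitProb (hf : Γ.LocallyFinite) {x y : V} {r n : ℝ} {k : ℕ}
    (hk : (k : ℝ) < n) : Γ.hitBy (Γ.ball y r) k x ≤ Γ.hitProb x y r n := by
  have h1 : (avoiding (Γ.ball y r) k)ᶜ ⊆
      {ω : ℕ → V | (hittingTime (Γ.ball y r) ω : ℝ≥0∞) < ENNReal.ofReal n} := by
    intro ω hω
    simp only [avoiding, Set.mem_compl_iff, Set.mem_ofPred_eq, not_forall, not_not] at hω
    obtain ⟨t, ht, hA⟩ := hω
    have h2 : hittingTime (Γ.ball y r) ω ≤ t := exitTime_le (by simpa using hA)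
    have h3 : (hittingTime (Γ.ball y r) ω : ℝ≥0∞) ≤ ((t : ℕ∞) : ℝ≥0∞) := by exact_mod_cast h2
    refine h3.trans_lt ?_
    rw [ENat.toENNReal_coe, ENNReal.lt_ofReal_iff_toReal_lt (ENNReal.natCast_ne_top t),
      ENNReal.toReal_natCast]
    exact lt_of_le_of_lt (by exact_mod_cast ht) hk
  calc Γ.hitBy (Γ.ball y r) k x = 1 - (Γ.law x).real (avoiding (Γ.ball y r) k) := by
        rw [hf.law_avoiding]; ring
    _ = (Γ.law x).real (avoiding (Γ.ball y r) k)ᶜ :=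
        (probReal_compl_eq_one_sub (measurableSet_avoiding _ _)).symm
    _ ≤ _ := measureReal_mono h1

/-- The exit time dominates the sum over `k < K` of the indicators of not having left the ball by
time `k`. -/
theorem LocallyFinite.sum_le_meanExitTime (hf : Γ.LocallyFinite) (x : V) (R : ℝ) (K : ℕ) :
    ENNReal.ofReal (∑ k ∈ Finset.range K, (1 - Γ.hitBy (Γ.ball x R)ᶜ k x)) ≤
      Γ.meanExitTime x R := by
  set D := Γ.ball x R
  rw [ENNReal.ofReal_sum_of_nonneg fun k _ => by linarith [hf.hitBy_le_one Dᶜ k x]]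
  have h1 : ∀ k, ENNReal.ofReal (1 - Γ.hitBy Dᶜ k x) =
      ∫⁻ ω, (avoiding Dᶜ k).indicator 1 ω ∂(Γ.law x) := fun k => by
    rw [lintegral_indicator_one (measurableSet_avoiding _ _), ← hf.law_avoiding, ofReal_measureReal]
  simp_rw [h1]
  rw [← lintegral_finsetSum _ fun k _ => measurable_one.indicator (measurableSet_avoiding _ _)]
  refine lintegral_mono fun ω => ?_
  have h2 : ∀ K : ℕ, ∑ k ∈ Finset.range K, (avoiding Dᶜ k).indicator (1 : (ℕ → V) → ℝ≥0∞) ω ≤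
      ((exitTime D ω : ℕ∞) : ℝ≥0∞) := by
    intro K
    induction K with
    | zero => simp
    | succ K ih =>
      rw [Finset.sum_range_succ]
      by_cases hK : ω ∈ avoiding Dᶜ K
      · have h3 : ((K + 1 : ℕ) : ℕ∞) ≤ exitTime D ω :=
          le_exitTime fun t ht => by simpa using hK t (Nat.lt_succ_iff.1 ht)
        have h4 : (((K + 1 : ℕ) : ℕ∞) : ℝ≥0∞) ≤ ((exitTime D ω : ℕ∞) : ℝ≥0∞) := by
          exact_mod_cast h3
        refine le_trans ?_ h4
        rw [← Finset.sum_range_succ (fun k => (avoiding Dᶜ k).indicator (1 : (ℕ → V) → ℝ≥0∞) ω)]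
        refine (Finset.sum_le_card_nsmul _ _ 1 fun k _ => ?_).trans_eq (by simp)
        exact Set.indicator_le_self' (fun _ _ => zero_le_one) ω
      · rwa [Set.indicator_of_notMem hK, add_zero]
  exact h2 K

/-- The solution of the exit-time equation is a lower bound for the mean exit time. -/
theorem IsExit.le_meanExitTime (hf : Γ.LocallyFinite) {x : V} {R : ℝ} {e : V → ℝ}
    (he : Γ.IsExit (Γ.ball x R) e) : ENNReal.ofReal (e x) ≤ Γ.meanExitTime x R := by
  set D := Γ.ball x R with hDdef
  have hD : D.Finite := hf.finite_ball x R
  -- The truncated mean exit times increase, stay below `e`, and satisfy `v (K+1) = 1 + P v K` on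
  -- `D`. Their limit solves the exit equation, so comparison gives `e ≤ l`.
  let v : ℕ → V → ℝ := fun K w => ∑ k ∈ Finset.range K, (1 - Γ.hitBy Dᶜ k w)
  have hmono : ∀ w, Monotone fun K => v K w := fun w => monotone_nat_of_le_succ fun K => by
    simp only [v, Finset.sum_range_succ]
    linarith [hf.hitBy_le_one Dᶜ K w]
  have hout : ∀ K, ∀ w ∉ D, v K w = 0 := fun K w hw =>
    Finset.sum_eq_zero fun k _ => by rw [hitBy_of_mem (by simpa using hw), sub_self]
  have hrec : ∀ K, ∀ w ∈ D, v (K + 1) w = 1 + Γ.avg (v K) w := by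
    intro K w hw
    have hw' : w ∉ Dᶜ := by simpa using hw
    induction K with
    | zero => simp [v, hitBy, hw', avg]
    | succ K ih =>
      have h1 : v (K + 1 + 1) w = v (K + 1) w + (1 - Γ.avg (Γ.hitBy Dᶜ K) w) := by
        simp only [v]
        rw [Finset.sum_range_succ _ (K + 1), hitBy_succ_of_notMem hw']
      have h2 : Γ.avg (v (K + 1)) w = Γ.avg (v K) w + (1 - Γ.avg (Γ.hitBy Dᶜ K) w) := by
        have : v (K + 1) = fun y => v K y + (1 - Γ.hitBy Dᶜ K y) :=
          funext fun y => Finset.sum_range_succ _ _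
        rw [this, hf.avg_add, hf.avg_sub, avg_const]
      rw [h1, h2, ih]
      ring
  have hle : ∀ K w, v K w ≤ e w := by
    intro K
    induction K with
    | zero => exact fun w => by simpa [v] using he.nonneg hf hD w
    | succ K ih =>
      intro w
      by_cases hw : w ∈ D
      · rw [hrec K w hw]
        linarith [he.1 w hw, hf.avg_mono (x := w) fun y _ => ih y]
      · rw [hout _ w hw, he.2 w hw]
  have hlim : ∀ w, ∃ l, Filter.Tendsto (fun K => v K w) Filter.atTop (nhds l) := fun w =>
    ⟨_, tendsto_atTop_ciSup (hmono w) ⟨e w, by rintro _ ⟨K, rfl⟩; exact hle K w⟩⟩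
  choose l hl using hlim
  have hlrec : ∀ w ∈ D, l w = 1 + Γ.avg l w := fun w hw => by
    refine tendsto_nhds_unique ((Filter.tendsto_add_atTop_iff_nat 1).2 (hl w)) ?_
    simp_rw [hrec _ w hw]
    exact (hf.tendsto_avg hl w).const_add 1
  have hlout : ∀ w ∉ D, l w = 0 := fun w hw => by
    refine tendsto_nhds_unique (hl w) ?_
    simp_rw [hout _ w hw]
    exact tendsto_const_nhds
  have hel : e x ≤ l x :=
    IsExit.mono hf hD subset_rfl he ⟨fun w hw => by linarith [hlrec w hw], hlout⟩ x
  refine (ENNReal.ofReal_le_ofReal hel).trans ?_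
  exact le_of_tendsto' ((ENNReal.continuous_ofReal.tendsto _).comp (hl x))
    fun K => hf.sum_le_meanExitTime x R K

theorem meanExitTime_eq_zero {z : V} {R : ℝ} (hR : R ≤ 0) : Γ.meanExitTime z R = 0 := by
  have h : ∀ ω : ℕ → V, exitTime (Γ.ball z R) ω = 0 := fun ω => by
    have h0 : ω 0 ∉ Γ.ball z R := fun h => by
      have h1 : (Γ.d z (ω 0) : ℝ) < R := h
      have h2 : (0 : ℝ) ≤ Γ.d z (ω 0) := Nat.cast_nonneg _
      linarith
    exact le_antisymm (by simpa using exitTime_le h0) zero_le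
  simp [meanExitTime, h]

end PathSpace

end WeightedGraph

/-! ### The two regimes and the conclusion. -/

namespace WeightedGraph

variable {V : Type*} {Γ : WeightedGraph V} [Infinite V] [MeasurableSpace V]
  [DiscreteMeasurableSpace V]

theorem LocallyFinite.exp_le_hitProb (hf : Γ.LocallyFinite) {p : ℝ} (hp : 0 < p) (hp1 : p ≤ 1)
    (hP : ∀ x y, Γ.graph.Adj x y → p ≤ Γ.P x y) {x y : V} {r n : ℝ} (hr : 1 ≤ r)
    (hd : r ≤ Γ.d x y) (hn : (Γ.d x y : ℝ) - ⌈r⌉ + 1 < n) :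
    p * Real.exp (Real.log p * (Γ.d x y - r)) ≤ Γ.hitProb x y r n := by
  have hm : ((⌈r⌉₊ : ℕ) : ℝ) = ⌈r⌉ := natCast_ceil_eq_intCast_ceil (by linarith)
  have hm1 : 1 ≤ ⌈r⌉₊ := Nat.one_le_ceil_iff.2 (by linarith)
  have hmd : ⌈r⌉₊ ≤ Γ.d x y := Nat.ceil_le.2 hd
  have hrm : r ≤ (⌈r⌉₊ : ℝ) := Nat.le_ceil r
  have hmr : ((⌈r⌉₊ : ℕ) : ℝ) < r + 1 := Nat.ceil_lt_add_one (by linarith)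
  -- Integer distances below `r` are those at most `⌈r⌉ - 1`, so `k = d(x,y) - ⌈r⌉ + 1` steps reach
  -- the ball, and the hypothesis says `k < n`. As `k ≤ d(x,y) - r + 1`, one extra factor `p` is
  -- lost.
  obtain ⟨k, hk⟩ : ∃ k, k + ⌈r⌉₊ = Γ.d x y + 1 := ⟨Γ.d x y + 1 - ⌈r⌉₊, by omega⟩
  have hk' : (k : ℝ) + (⌈r⌉₊ : ℝ) = Γ.d x y + 1 := by exact_mod_cast hk
  obtain ⟨z, hxz, hzy⟩ := Γ.exists_between (x := x) (y := y) (m := k) (by omega)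
  have hzA : z ∈ Γ.ball y r := by
    have h1 : Γ.d y z + 1 = ⌈r⌉₊ := by rw [d_comm]; omega
    have h2 : (Γ.d y z : ℝ) + 1 = (⌈r⌉₊ : ℝ) := by exact_mod_cast h1
    change (Γ.d y z : ℝ) < r
    linarith
  calc p * Real.exp (Real.log p * (Γ.d x y - r))
      = Real.exp (Real.log p * (Γ.d x y - r + 1)) := by
        rw [mul_add, mul_one, Real.exp_add, Real.exp_log hp, mul_comm]
    _ ≤ Real.exp (Real.log p * k) := by
        refine Real.exp_le_exp.2 (mul_le_mul_of_nonpos_left ?_ (Real.log_nonpos hp.le hp1))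
        linarith
    _ = p ^ k := by rw [mul_comm, Real.exp_nat_mul, Real.exp_log hp]
    _ ≤ Γ.hitBy (Γ.ball y r) k x := hf.pow_le_hitBy hp.le hP k hxz.le hzA
    _ ≤ Γ.hitProb x y r n := hf.hitBy_le_hitProb (by rw [← hm] at hn; linarith)

theorem HarnackStep.le_hitProb {C : ℝ} (hC : Γ.HarnackStep C) (hf : Γ.LocallyFinite) {x y : V}
    {r n : ℝ} (hd : (Γ.d x y : ℝ) ≤ 4 * r) (hn : 0 < n) {l : ℕ}
    (hl : l ∈ Γ.admissible (2 * (C ^ 21 + 12 * C ^ 196)) 1 x y n (Γ.d x y - r))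
    (hR : 200 * (l : ℝ) ≤ Γ.d x y - r) :
    1 / 2 * Real.exp (-(1644 * Real.log C) * l) ≤ Γ.hitProb x y r n := by
  have hC0 : 0 < C := zero_lt_one.trans_le hC.1
  obtain ⟨hl0, hE⟩ := hl
  have hl1 : (1 : ℝ) ≤ l := by exact_mod_cast hl0
  set R : ℝ := Γ.d x y - r with hRdef
  set ρ : ℕ := ⌊R / (200 * l)⌋₊ with hρdef
  have hl200 : (0 : ℝ) < 200 * l := by linarith
  have hq1 : 1 ≤ R / (200 * l) := (one_le_div hl200).2 hR
  have hρ : 1 ≤ ρ := (Nat.one_le_floor_iff _).2 hq1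
  have hρ1 : (1 : ℝ) ≤ ρ := by exact_mod_cast hρ
  have hρle : (ρ : ℝ) * (200 * l) ≤ R :=
    (le_div_iff₀ hl200).1 (Nat.floor_le (by linarith))
  have hρgt : R < (ρ + 1) * (200 * l) := (div_lt_iff₀ hl200).1 (Nat.lt_floor_add_one _)
  have hρ0 : (0 : ℝ) < 42 * ρ := by linarith
  have hR0 : 0 ≤ R := by linarith
  -- Fewest links that bring the `17ρ`-ball about the last point inside `B(y,r)`.
  set L : ℕ := ⌈(R + 17 * ρ) / (42 * ρ)⌉₊ with hLdef
  have hL1 : R + 17 * ρ ≤ L * (42 * ρ) := (div_le_iff₀ hρ0).1 (Nat.le_ceil _)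
  have hL2 : L * (42 * ρ) < R + 59 * ρ := by
    have h := Nat.ceil_lt_add_one (a := (R + 17 * ρ) / (42 * ρ)) (by positivity)
    rw [← hLdef, ← sub_lt_iff_lt_add, lt_div_iff₀ hρ0] at h
    linarith
  have hρl : (ρ : ℝ) ≤ ρ * l := le_mul_of_one_le_right (by linarith) hl1
  have hL3 : (L : ℝ) ≤ 12 * l := by
    have h1 : (l : ℝ) ≤ ρ * l := le_mul_of_one_le_left (by linarith) hρ1
    have h2 : (L : ℝ) * (42 * ρ) ≤ 12 * l * (42 * ρ) := by nlinarith
    exact le_of_mul_le_mul_right h2 hρ0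
  -- The chain must not overshoot `y`. This is where `d(x,y) ≤ 4r` enters: `200ρ ≤ R ≤ 3r` gives
  -- `59ρ ≤ r`.
  have hLd : L * (42 * ρ) ≤ Γ.d x y := by
    have : (L : ℝ) * (42 * ρ) ≤ Γ.d x y := by linarith
    exact_mod_cast this
  obtain ⟨p, hp⟩ := Γ.connected.exists_walk_length_eq_dist x y
  have hp' : p.length = Γ.d x y := hp
  have hstep : ∀ i < L, Γ.d (p.getVert (i * (42 * ρ))) (p.getVert ((i + 1) * (42 * ρ))) =
      42 * ρ := fun i hi => by
    have h1 : (i + 1) * (42 * ρ) ≤ L * (42 * ρ) := Nat.mul_le_mul_right _ hi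
    have h2 : (i + 1) * (42 * ρ) = i * (42 * ρ) + 42 * ρ := by ring
    rw [d_getVert hp' (by omega) (by omega)]
    omega
  have hA : Γ.nball (p.getVert (L * (42 * ρ))) (17 * ρ) ⊆ Γ.ball y r := by
    intro v hv
    have h1 : Γ.d (p.getVert (L * (42 * ρ))) y = Γ.d x y - L * (42 * ρ) := by
      have h := d_getVert hp' hLd le_rfl
      rwa [← hp', p.getVert_length, hp'] at h
    have h2 := Γ.d_triangle y (p.getVert (L * (42 * ρ))) v
    rw [mem_nball] at hv
    have h3 : Γ.d y v + L * (42 * ρ) < Γ.d x y + 17 * ρ := by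
      rw [d_comm] at h1
      omega
    have h4 : (Γ.d y v : ℝ) + L * (42 * ρ) < Γ.d x y + 17 * ρ := by exact_mod_cast h3
    change (Γ.d y v : ℝ) < r
    linarith
  set Q : ℝ := 2 * (C ^ 21 + 12 * C ^ 196) with hQdef
  have hCa : 0 < C ^ 21 := pow_pos hC0 _
  have hCb : 0 < C ^ 196 := pow_pos hC0 _
  have hQ : 0 < Q := by linarith
  have hl' : (0 : ℝ) < l := by linarith
  have hexit : ∀ i ≤ L, ∀ e, Γ.IsExit (Γ.nball (p.getVert (i * (42 * ρ))) (100 * ρ)) e →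
      e (p.getVert (i * (42 * ρ))) ≤ n / l / Q := by
    intro i _ e he
    set z := p.getVert (i * (42 * ρ))
    have hfin := hf.finite_ball z (1 * R / l)
    obtain ⟨e', he'⟩ := hf.exists_isExit hfin
    have hsub : Γ.nball z (100 * ρ) ⊆ Γ.ball z (1 * R / l) := nball_subset_ball (by
      push_cast
      rw [le_div_iff₀ hl']
      nlinarith)
    have h1 := hE z ⟨p, hp', p.getVert_mem_support _⟩
    have h2 := (mul_le_mul_right (he'.le_meanExitTime hf) (ENNReal.ofReal Q)).trans h1
    rw [← ENNReal.ofReal_mul hQ.le, ENNReal.ofReal_le_ofReal_iff (by positivity)] at h2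
    rw [le_div_iff₀ hQ]
    have h3 := mul_le_mul_of_nonneg_left (he.mono hf hfin hsub he' z) hQ.le
    linarith
  -- The largest integer time strictly below `n`.
  obtain ⟨k, hk⟩ : ∃ k, k + 1 = ⌈n⌉₊ := ⟨⌈n⌉₊ - 1, by have := Nat.ceil_pos.2 hn; omega⟩
  have hkn : (k : ℝ) < n := Nat.lt_ceil.1 (by omega)
  have hnk : n ≤ (k : ℝ) + 1 := by exact_mod_cast hk ▸ Nat.le_ceil n
  have htime : 2 * ((C ^ 21 + L * C ^ 196) * (n / l / Q)) ≤ (k : ℝ) + 1 := by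
    refine le_trans ?_ hnk
    have h1 : 2 * (C ^ 21 + L * C ^ 196) ≤ l * Q := by
      have h2 := mul_le_mul_of_nonneg_right hL3 hCb.le
      have h3 := mul_le_mul_of_nonneg_right hl1 hCa.le
      rw [hQdef]
      linarith
    calc 2 * ((C ^ 21 + L * C ^ 196) * (n / l / Q))
        = 2 * (C ^ 21 + L * C ^ 196) * (n / (l * Q)) := by rw [div_div]; ring
      _ ≤ l * Q * (n / (l * Q)) := mul_le_mul_of_nonneg_right h1 (by positivity)
      _ = n := by field_simp
  have hmain := hC.le_hitBy hf hρ L (fun i => p.getVert (i * (42 * ρ))) hstep hexit hA htime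
  simp only [zero_mul, p.getVert_zero] at hmain
  have hpow : (C ^ 137) ^ L ≤ Real.exp (1644 * Real.log C * l) := by
    rw [← pow_mul, ← Real.exp_log (pow_pos hC0 (137 * L)), Real.log_pow]
    refine Real.exp_le_exp.2 ?_
    have h1 := mul_le_mul_of_nonneg_right hL3 (Real.log_nonneg hC.1)
    push_cast
    linarith
  have hu0 := hitBy_nonneg (Γ := Γ) (Γ.ball y r) k x
  have h1 := hmain.trans (mul_le_mul_of_nonneg_right hpow hu0)
  rw [neg_mul, Real.exp_neg, ← div_eq_mul_inv, div_le_iff₀ (Real.exp_pos _), mul_comm]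
  exact h1.trans (mul_le_mul_of_nonneg_left (hf.hitBy_le_hitProb hkn) (Real.exp_pos _).le)

theorem one_mem_admissible {Q C : ℝ} (hC : 0 ≤ C) (x y : V) (n : ℝ) {R : ℝ} (hR : R ≤ 0) :
    1 ∈ Γ.admissible Q C x y n R := by
  refine ⟨one_pos, fun z _ => ?_⟩
  have h : C * R / (1 : ℕ) ≤ 0 := by
    rw [Nat.cast_one, div_one]
    exact mul_nonpos_of_nonneg_of_nonpos hC hR
  rw [meanExitTime_eq_zero h, mul_zero]
  exact zero_le

end WeightedGraph

theorem proposition3p6 {V : Type*} [Infinite V] [MeasurableSpace V] [DiscreteMeasurableSpace V]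
    (Γ : WeightedGraph V) (hp₀ : Γ.UniformlyElliptic) (hH : Γ.EllipticHarnack) :
    ∃ Q c C C' : ℝ, 0 < Q ∧ 0 < c ∧ 0 < C ∧ 0 < C' ∧ ∀ (x y : V) (r n : ℝ),
      1 ≤ r → (Γ.d x y : ℝ) ≤ 4 * r → 0 < n → (Γ.d x y : ℝ) - ⌈r⌉ + 1 < n →
        c * Real.exp (-C' * Γ.chainLength Q C x y n ((Γ.d x y : ℝ) - r)) ≤ Γ.hitProb x y r n := by
  have hf := hp₀.locallyFinite
  obtain ⟨K, hK⟩ := hH.exists_harnackStep hf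
  obtain ⟨p, hp, hP⟩ := hp₀
  have hp1 : p ≤ 1 := by
    obtain ⟨x⟩ : Nonempty V := inferInstance
    obtain ⟨y, hy⟩ := Γ.connected.preconnected.exists_adj_of_nontrivial x
    have := hf.P_mul_le_avg (f := fun _ => 1) (fun _ => zero_le_one) x y
    rw [WeightedGraph.avg_const, mul_one] at this
    exact (hP x y hy).trans this
  have hK0 : 0 < K := zero_lt_one.trans_le hK.1
  have hKa : 0 < K ^ 21 := pow_pos hK0 _
  have hKb : 0 < K ^ 196 := pow_pos hK0 _
  have hlogp : Real.log p ≤ 0 := Real.log_nonpos hp.le hp1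
  have hlogK : 0 ≤ Real.log K := Real.log_nonneg hK.1
  -- `1644 = 12 · 137` is the loss along the chain, `200` the threshold between regimes; the summand
  -- `1` keeps `C'` positive. Up to `c`, one `C'` serves both regimes since both logarithmic terms
  -- are non-negative.
  refine ⟨2 * (K ^ 21 + 12 * K ^ 196), p / 2, 1, 1 - 200 * Real.log p + 1644 * Real.log K,
    by linarith, by linarith, one_pos, by linarith, fun x y r n hr hd hn hdn => ?_⟩
  set C' := 1 - 200 * Real.log p + 1644 * Real.log K with hC'
  set l := Γ.chainLength (2 * (K ^ 21 + 12 * K ^ 196)) 1 x y n (Γ.d x y - r) with hl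
  have path : r ≤ Γ.d x y → 0 ≤ l → Γ.d x y - r ≤ 200 * l →
      p / 2 * Real.exp (-C' * l) ≤ Γ.hitProb x y r n := fun h1 h2 h3 => by
    refine le_trans ?_ (hf.exp_le_hitProb hp hp1 hP hr h1 hdn)
    refine mul_le_mul (by linarith) (Real.exp_le_exp.2 ?_) (Real.exp_pos _).le hp.le
    have h4 := mul_le_mul_of_nonpos_left h3 hlogp
    have h5 := mul_nonneg hlogK h2
    rw [hC']
    linarith
  by_cases hadm : (Γ.admissible (2 * (K ^ 21 + 12 * K ^ 196)) 1 x y n (Γ.d x y - r)).Nonempty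
  · have hmem := Nat.sInf_mem hadm
    have hl' : l =
        (sInf (Γ.admissible (2 * (K ^ 21 + 12 * K ^ 196)) 1 x y n (Γ.d x y - r)) : ℕ) := by
      rw [hl, WeightedGraph.chainLength, if_pos hadm]
    have hl0 : 0 ≤ l := hl' ▸ Nat.cast_nonneg _
    rcases lt_or_ge (Γ.d x y : ℝ) r with hlt | hge
    · have hx : x ∈ Γ.ball y r := by
        change (Γ.d y x : ℝ) < r
        rwa [WeightedGraph.d_comm]
      have h1 := hf.hitBy_le_hitProb (Γ := Γ) (x := x) (y := y) (r := r) (k := 0) (n := n)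
        (by simpa using hn)
      rw [WeightedGraph.hitBy_of_mem hx] at h1
      have h2 : Real.exp (-C' * l) ≤ 1 := Real.exp_le_one_iff.2 (by
        have : 0 ≤ C' := by linarith
        nlinarith)
      have h3 := Real.exp_pos (-C' * l)
      nlinarith
    · rcases le_total (Γ.d x y - r) (200 * l) with h1 | h1
      · exact path hge hl0 h1
      · refine le_trans ?_ (hK.le_hitProb hf hd hn hmem (by rw [← hl']; exact h1))
        rw [← hl']
        refine mul_le_mul (by linarith) (Real.exp_le_exp.2 ?_) (Real.exp_pos _).le (by norm_num)
        have h4 := mul_nonneg (neg_nonneg.2 hlogp) hl0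
        rw [hC']
        linarith
  -- Without an admissible length, `R > 0` and the default `l = R` satisfies `R ≤ 200 l`, so the
  -- direct path suffices.
  · have hl' : l = Γ.d x y - r := by rw [hl, WeightedGraph.chainLength, if_neg hadm]
    have hR : 0 < Γ.d x y - r := by
      by_contra! hcon
      exact hadm ⟨1, WeightedGraph.one_mem_admissible zero_le_one x y n hcon⟩
    exact path (by linarith) (by linarith) (by linarith)
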